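/- All spaces are pointed and have the (pointed) homotopy type of a connected CW-complex; maps and homotopies preserve base points, and $\simeq$ denotes pointed homotopy equivalence. For an H-space $X$ let $\mathrm{End}(X)=([X,X],+,\cdot)$ be the loop near-ring of homotopy classes of self-maps of $X$, where $\cdot$ is composition, $+$ is induced by the H-structure, $\mathbf 0_X$ is the class of the constant map and $\mathbf 1_X$ that of the identity. The space $X$ is \emph{indecomposable} if $\mathbf 0_X\neq\mathbf 1_X$ (i.e. $X$ is not contractible) and $\mathbf 0_X,\mathbf 1_X$ are the only idempotents of $\mathrm{End}(X)$. An \emph{$N$-subloop} of a loop near-ring $N$ is a subloop $I$ of $(N,+)$ (a subset containing $0$ and closed under addition and under solving $a+x=b$ and $y+a=b$ with $a,b\in I$) such that $NI\subseteq I$; $N$ is \emph{local} if it has a unique maximal proper $N$-subloop. An H-space $X$ is \emph{strongly indecomposable} if $\mathrm{End}(X)$ is local. A space $Z$ is a \emph{retract} of $X$ if there are maps $j\colon Z\to X$ and $p\colon X\to Z$ with $pj\simeq \mathbf 1_Z$. \textbf{Theorem.} Assume that an H-space $X$ admits a finite product decomposition $X\simeq X_1\times\cdots\times X_n$ into strongly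 indecomposable H-spaces $X_i$. Then: (i) Any indecomposable retract $Z$ of $X$ is strongly indecomposable (that is, $Z$ admits an H-structure, and $\mathrm{End}(Z)$ is local for every H-structure on $Z$). Moreover, there is an index $i$ such that $Z\simeq X_i$. (ii) If $X\simeq X'_1\times\cdots\times X'_m$ is any other decomposition of $X$ into indecomposable factors $X'_k$, then $m=n$, and there is a permutation $\varphi$ such that $X_i\simeq X'_{\varphi(i)}$ for all $i$. -/

import Mathlib

universe u v w t

/-- A pointed topological space. -/
structure PtdSpace : Type (u + 1) where
  carrier : Type u
  [top : TopologicalSpace carrier]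
  pt : carrier

namespace PtdSpace

instance : CoeSort PtdSpace.{u} (Type u) := ⟨PtdSpace.carrier⟩

instance (X : PtdSpace.{u}) : TopologicalSpace X := X.top

/-- The product of a family of pointed spaces, with the product topology. -/
def pi {ι : Type w} (F : ι → PtdSpace.{v}) : PtdSpace.{max w v} where
  carrier := ∀ i, F i
  pt := fun i => (F i).pt

/-- Base-point preserving continuous maps. -/
def Map (X : PtdSpace.{u}) (Y : PtdSpace.{v}) : Type (max u v) :=
  {f : C(X, Y) // f X.pt = Y.pt}

namespace Map

variable {X : PtdSpace.{u}} {Y : PtdSpace.{v}} {Z : PtdSpace.{w}}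

/-- The identity map. -/
def id (X : PtdSpace.{u}) : Map X X := ⟨ContinuousMap.id X, rfl⟩

/-- The constant map at the base point. -/
def zero (X : PtdSpace.{u}) (Y : PtdSpace.{v}) : Map X Y :=
  ⟨ContinuousMap.const X Y.pt, rfl⟩

/-- Composition `g ∘ f`. -/
def comp (g : Map Y Z) (f : Map X Y) : Map X Z :=
  ⟨g.1.comp f.1, (congrArg g.1 f.2).trans g.2⟩

/-- Base-point preserving homotopy of pointed maps. -/
def Homotopic (f g : Map X Y) : Prop := f.1.HomotopicRel g.1 {X.pt}

theorem Homotopic.comp {f f' : Map X Y} {g g' : Map Y Z}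
    (hg : Homotopic g g') (hf : Homotopic f f') : Homotopic (g.comp f) (g'.comp f') := by
  obtain ⟨G⟩ := hg
  refine ContinuousMap.HomotopicRel.trans (hf.comp_continuousMap g.1)
    ⟨⟨G.toHomotopy.compContinuousMap f'.1, ?_⟩⟩
  rintro s x rfl
  refine G.eq_fst s ?_
  exact f'.2

/-- The setoid of pointed homotopy. -/
instance setoid (X : PtdSpace.{u}) (Y : PtdSpace.{v}) : Setoid (Map X Y) where
  r := Homotopic
  iseqv := ⟨fun _ => ContinuousMap.HomotopicRel.refl _,
    fun h => ContinuousMap.HomotopicRel.symm h,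
    fun h k => ContinuousMap.HomotopicRel.trans h k⟩

end Map

/-- `X` and `Y` are pointed homotopy equivalent. -/
def HEquiv (X : PtdSpace.{u}) (Y : PtdSpace.{v}) : Prop :=
  ∃ (f : Map X Y) (g : Map Y X),
    (g.comp f).Homotopic (Map.id X) ∧ (f.comp g).Homotopic (Map.id Y)

/-- `Z` is a retract of `X`, in the pointed homotopy category. -/
def IsRetract (Z : PtdSpace.{v}) (X : PtdSpace.{u}) : Prop :=
  ∃ (j : Map Z X) (p : Map X Z), (p.comp j).Homotopic (Map.id Z)

/-- `X` has the (pointed) homotopy type of a connected CW-complex; as usual, the base point of a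
pointed CW-complex is a vertex. -/
def HasConnectedCWType (X : PtdSpace.{u}) : Prop :=
  ∃ (K : PtdSpace.{u}) (_ : T2Space K) (_ : ConnectedSpace K)
    (_ : Topology.CWComplex (Set.univ : Set K)),
    (∃ i : Topology.RelCWComplex.cell (Set.univ : Set K) 0,
      K.pt ∈ Topology.RelCWComplex.openCell 0 i) ∧ HEquiv X K

/-- An H-space structure on the pointed space `X`, with the base point as the homotopy unit. -/
structure HStructure (X : PtdSpace.{u}) where
  toHSpace : HSpace X
  e_eq : toHSpace.e = X.pt

/-- The sum `f + g = μ ∘ (f, g)` of two maps into an H-space. -/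
def Map.add {X : PtdSpace.{u}} {Y : PtdSpace.{v}} (H : HStructure Y) (f g : Map X Y) : Map X Y :=
  ⟨H.toHSpace.hmul.comp (f.1.prodMk g.1), by
    have h := H.toHSpace.hmul_e_e
    rw [H.e_eq] at h
    simpa [f.2, g.2] using h⟩

theorem Map.Homotopic.add {X : PtdSpace.{u}} {Y : PtdSpace.{v}} (H : HStructure Y)
    {f f' g g' : Map X Y} (hf : f.Homotopic f') (hg : g.Homotopic g') :
    (Map.add H f g).Homotopic (Map.add H f' g') := by
  obtain ⟨F⟩ := hf
  obtain ⟨G⟩ := hg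
  exact ⟨(ContinuousMap.HomotopyRel.prod F G).compContinuousMap H.toHSpace.hmul⟩

/-- The set `[X, X]` of pointed homotopy classes of pointed self-maps. -/
def SelfMaps (X : PtdSpace.{u}) : Type u := Quotient (Map.setoid X X)

instance (X : PtdSpace.{u}) : Zero (SelfMaps X) := ⟨Quotient.mk _ (Map.zero X X)⟩

instance (X : PtdSpace.{u}) : One (SelfMaps X) := ⟨Quotient.mk _ (Map.id X)⟩

/-- Multiplication in `[X, X]` is composition. -/
instance (X : PtdSpace.{u}) : Mul (SelfMaps X) :=
  ⟨Quotient.map₂ Map.comp fun _ _ hg _ _ hf => Map.Homotopic.comp hg hf⟩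

/-- The set `[X, X]`, for `X` with a chosen H-structure, carrying the operations of the
loop near-ring `End(X)`. -/
def End (X : PtdSpace.{u}) (_H : HStructure X) : Type u := SelfMaps X

instance (X : PtdSpace.{u}) (H : HStructure X) : Zero (End X H) :=
  inferInstanceAs (Zero (SelfMaps X))

instance (X : PtdSpace.{u}) (H : HStructure X) : One (End X H) :=
  inferInstanceAs (One (SelfMaps X))

instance (X : PtdSpace.{u}) (H : HStructure X) : Mul (End X H) :=
  inferInstanceAs (Mul (SelfMaps X))

/-- Addition in `End(X)` is induced by the H-structure. -/
instance (X : PtdSpace.{u}) (H : HStructure X) : Add (End X H) :=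
  ⟨Quotient.map₂ (Map.add H) fun _ _ hf _ _ hg => Map.Homotopic.add H hf hg⟩

end PtdSpace

/-- `N`-subloops of a loop near-ring `N`: subsets which contain zero, are closed under addition
and under both difference operations (the difference of `a` and `b` being the solution `x` of
`a + x = b`, respectively `x + a = b`), and are stable under left multiplication by `N`. -/
structure IsNSubloop {N : Type u} [Zero N] [Add N] [Mul N] (I : Set N) : Prop where
  zero_mem : 0 ∈ I
  add_mem : ∀ a ∈ I, ∀ b ∈ I, a + b ∈ I
  left_diff_mem : ∀ a ∈ I, ∀ b ∈ I, ∀ x, a + x = b → x ∈ I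
  right_diff_mem : ∀ a ∈ I, ∀ b ∈ I, ∀ x, x + a = b → x ∈ I
  mul_mem : ∀ n : N, ∀ a ∈ I, n * a ∈ I

/-- A maximal `N`-subloop: a proper `N`-subloop contained in no other proper `N`-subloop. -/
def IsMaximalNSubloop {N : Type u} [Zero N] [Add N] [Mul N] (J : Set N) : Prop :=
  IsNSubloop J ∧ J ≠ Set.univ ∧
    ∀ K : Set N, IsNSubloop K → K ≠ Set.univ → J ⊆ K → K = J

/-- A loop near-ring is local if it has a unique maximal `N`-subloop. -/
def IsLocalLoopNearRing (N : Type u) [Zero N] [Add N] [Mul N] : Prop :=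
  ∃! J : Set N, IsMaximalNSubloop J

namespace PtdSpace

/-- `X` is indecomposable: it is not contractible, and `0` and `1` are the only idempotents of
`[X, X]`. The H-structure does not enter. -/
def Indecomposable (X : PtdSpace.{u}) : Prop :=
  (0 : SelfMaps X) ≠ 1 ∧ ∀ e : SelfMaps X, e * e = e → e = 0 ∨ e = 1

/-- The H-space `X` is strongly indecomposable: `End(X)` is a local loop near-ring. -/
def StronglyIndecomposable (X : PtdSpace.{u}) (H : HStructure X) : Prop :=
  IsLocalLoopNearRing (End X H)

end PtdSpace

/-! Replace a pointed map by the homomorphism it induces on the product of all homotopy groups of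
positive degree (`Pis`, with n-th component π_{n+1}). For an H-space target this assignment is
additive, by Eckmann–Hilton, so the loop near-ring End(X) maps onto an honest ring of "realizable"
endomorphisms of an abelian group. The map need not be injective, but by Whitehead's theorem it
detects units: between spaces of connected CW type a map is an equivalence exactly when its
homomorphism is bijective, and the inverse is then again realizable. Realizable homomorphisms are
closed under sums and composites, and also under negatives, which come from inverting the shear map
(x, y) ↦ (x, x + y) on homotopy groups (`exists_pis_eq_neg`).

Locality of End(X) is equivalent to locality of this ring (`StronglyIndecomposable.isLoc`,
`IsLoc.stronglyIndecomposable`). The ring does not depend on the H-structure, hence neither does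
strong indecomposability. The theorem becomes Krull–Schmidt–Azumaya for realizable homomorphisms. If
Z is a retract of X, its identity is a sum of endomorphisms factoring through the X_i, and locality
of the X_i produces some composite X_i → Z → X_i that is invertible (`exists_bijective_through`).
The resulting idempotent of Z can be formed from actual maps, so indecomposability of Z forces Z ≃
X_i (`Indecomposable.bijective_of_comp`). For two decompositions, the transition matrices are
mutually inverse with entries between local objects, and Gaussian elimination matches the factors
(`exists_bijOn_of_matrix`).

Whitehead's theorem is obtained from homotopy fibres: if f is bijective on homotopy groups, all
iterated loop spaces of its fibre are path-connected, so maps from spheres into the fibre extend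
over balls. This gives the end-point projection of the mapping path space of f the lifting property
for cells, and lifts are then built cell by cell. -/

namespace PtdSpace

noncomputable section

open scoped unitInterval

variable {X : PtdSpace.{u}} {Y : PtdSpace.{v}} {Z : PtdSpace.{w}}

/-! ### Loop spaces -/

/-- The loop space of a pointed space. -/
def loop (X : PtdSpace.{u}) : PtdSpace.{u} where
  carrier := Path X.pt X.pt
  pt := Path.refl X.pt

/-- A point of the loop space, as a path. -/
def loopPath (γ : X.loop) : Path X.pt X.pt := γ

/-- A closed path, as a point of the loop space. -/
def ofPath (γ : Path X.pt X.pt) : X.loop := γ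

/-- The image of a loop under a pointed map. -/
def Map.mapLoop (f : Map X Y) (γ : Path X.pt X.pt) : Path Y.pt Y.pt :=
  (γ.map f.1.continuous).cast f.2.symm f.2.symm

theorem continuous_loop_apply : Continuous fun p : X.loop × I => loopPath p.1 p.2 :=
  (Path.continuous_uncurry_iff (g := fun γ : Path X.pt X.pt => γ)).2 continuous_id

theorem continuous_to_loop {T : Type*} [TopologicalSpace T] {g : T → Path Y.pt Y.pt}
    (h : Continuous fun p : T × I => g p.1 p.2) : Continuous (g : T → Y.loop) :=
  Path.continuous_uncurry_iff.1 h

/-- The map of loop spaces induced by a pointed map. -/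
def Map.loop (f : Map X Y) : Map X.loop Y.loop :=
  ⟨⟨f.mapLoop, continuous_to_loop (f.1.continuous.comp continuous_loop_apply)⟩,
    Path.ext (funext fun _ => f.2)⟩

theorem Map.ext {f g : Map X Y} (h : ∀ x, f.1 x = g.1 x) : f = g :=
  Subtype.ext (ContinuousMap.ext h)

@[simp] theorem Map.id_apply (x : X) : (Map.id X).1 x = x := rfl
@[simp] theorem Map.zero_apply (x : X) : (Map.zero X Y).1 x = Y.pt := rfl
@[simp] theorem Map.comp_apply (g : Map Y Z) (f : Map X Y) (x : X) :
    (g.comp f).1 x = g.1 (f.1 x) := rfl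

@[simp] theorem Map.id_comp (f : Map X Y) : (Map.id Y).comp f = f := rfl
@[simp] theorem Map.comp_zero (f : Map Y Z) : f.comp (Map.zero X Y) = Map.zero X Z :=
  Map.ext fun _ => f.2

theorem Map.Homotopic.refl (f : Map X Y) : f.Homotopic f := ContinuousMap.HomotopicRel.refl _
theorem Map.Homotopic.symm {f g : Map X Y} (h : f.Homotopic g) : g.Homotopic f :=
  ContinuousMap.HomotopicRel.symm h
theorem Map.Homotopic.trans {f g h : Map X Y} (h₁ : f.Homotopic g) (h₂ : g.Homotopic h) :
    f.Homotopic h := ContinuousMap.HomotopicRel.trans h₁ h₂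

theorem Map.homotopic_iff {f g : Map X Y} : f.Homotopic g ↔
    ∃ F : I × X → Y, Continuous F ∧ (∀ x, F (0, x) = f.1 x) ∧ (∀ x, F (1, x) = g.1 x) ∧
      ∀ s, F (s, X.pt) = Y.pt := by
  constructor
  · rintro ⟨F⟩
    exact ⟨F, F.continuous, F.apply_zero, F.apply_one, fun s => (F.eq_fst s rfl).trans f.2⟩
  · rintro ⟨F, hF, h0, h1, hp⟩
    refine ⟨⟨⟨⟨F, hF⟩, h0, h1⟩, ?_⟩⟩
    rintro s x rfl
    exact (hp s).trans f.2.symm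

theorem Map.Homotopic.loop {f g : Map X Y} (h : f.Homotopic g) : f.loop.Homotopic g.loop := by
  obtain ⟨F, hF, h0, h1, hp⟩ := Map.homotopic_iff.1 h
  refine Map.homotopic_iff.2 ⟨fun p => (⟨⟨fun s => F (p.1, loopPath p.2 s), ?_⟩, ?_, ?_⟩ :
    Path Y.pt Y.pt), ?_, ?_, ?_, ?_⟩
  · fun_prop
  · simp [hp]
  · simp [hp]
  · refine continuous_to_loop (hF.comp (Continuous.prodMk (by fun_prop) ?_))
    exact continuous_loop_apply.comp (Continuous.prodMk (by fun_prop) (by fun_prop))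
  · intro γ; exact Path.ext (funext fun s => h0 _)
  · intro γ; exact Path.ext (funext fun s => h1 _)
  · intro s; exact Path.ext (funext fun _ => hp s)

/-- Pointwise multiplication of loops in an H-space. -/
def HStructure.loopMul (H : HStructure X) (γ δ : Path X.pt X.pt) : Path X.pt X.pt :=
  ⟨⟨fun s => H.toHSpace.hmul (γ s, δ s), by fun_prop⟩, by
    have h := H.toHSpace.hmul_e_e
    rw [H.e_eq] at h
    simp [h], by
    have h := H.toHSpace.hmul_e_e
    rw [H.e_eq] at h
    simp [h]⟩

theorem HStructure.hmul_pt (H : HStructure X) : H.toHSpace.hmul (X.pt, X.pt) = X.pt := by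
  have h := H.toHSpace.hmul_e_e
  rwa [H.e_eq] at h

theorem HStructure.zero_add_homotopic (H : HStructure Y) (f : Map X Y) :
    (Map.add H (Map.zero X Y) f).Homotopic f := by
  refine Map.homotopic_iff.2 ⟨fun p => H.toHSpace.eHmul (p.1, f.1 p.2), by fun_prop, ?_, ?_, ?_⟩
  · intro x
    refine (H.toHSpace.eHmul.apply_zero _).trans ?_
    simp [Map.add, H.e_eq]
  · intro x; exact H.toHSpace.eHmul.apply_one _
  · intro s
    refine (H.toHSpace.eHmul.eq_snd s ?_).trans f.2
    exact f.2.trans H.e_eq.symm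

theorem HStructure.add_zero_homotopic (H : HStructure Y) (f : Map X Y) :
    (Map.add H f (Map.zero X Y)).Homotopic f := by
  refine Map.homotopic_iff.2 ⟨fun p => H.toHSpace.hmulE (p.1, f.1 p.2), by fun_prop, ?_, ?_, ?_⟩
  · intro x
    refine (H.toHSpace.hmulE.apply_zero _).trans ?_
    simp [Map.add, H.e_eq]
  · intro x; exact H.toHSpace.hmulE.apply_one _
  · intro s
    refine (H.toHSpace.hmulE.eq_snd s ?_).trans f.2
    exact f.2.trans H.e_eq.symm

/-- A pointed multiplication with two-sided homotopy unit gives an H-structure. -/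
def HStructure.mk' (m : C(X × X, X)) (hm : m (X.pt, X.pt) = X.pt)
    (hl : Map.Homotopic (⟨m.comp ((ContinuousMap.const X X.pt).prodMk (ContinuousMap.id X)), hm⟩ :
      Map X X) (Map.id X))
    (hr : Map.Homotopic (⟨m.comp ((ContinuousMap.id X).prodMk (ContinuousMap.const X X.pt)), hm⟩ :
      Map X X) (Map.id X)) : HStructure X where
  toHSpace :=
    { hmul := m
      e := X.pt
      hmul_e_e := hm
      eHmul := hl.some
      hmulE := hr.some }
  e_eq := rfl

/-- The loop space of an H-space is an H-space under pointwise multiplication. -/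
def HStructure.loop (H : HStructure X) : HStructure X.loop :=
  HStructure.mk' (X := X.loop)
    ⟨fun p => H.loopMul p.1 p.2, by
      refine continuous_to_loop (H.toHSpace.hmul.continuous.comp (Continuous.prodMk ?_ ?_))
      · exact continuous_loop_apply.comp (Continuous.prodMk (by fun_prop) (by fun_prop))
      · exact continuous_loop_apply.comp (Continuous.prodMk (by fun_prop) (by fun_prop))⟩
    (Path.ext (funext fun _ => H.hmul_pt))
    (H.zero_add_homotopic (Map.id X)).loop (H.add_zero_homotopic (Map.id X)).loop

/-- The `n`-fold loop space. -/
def loopN : ℕ → PtdSpace.{u} → PtdSpace.{u}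
  | 0, X => X
  | n + 1, X => loopN n X.loop

/-- The map of `n`-fold loop spaces induced by a pointed map. -/
def Map.loopN : ∀ (n : ℕ) {X : PtdSpace.{u}} {Y : PtdSpace.{v}}, Map X Y →
    Map (X.loopN n) (Y.loopN n)
  | 0, _, _, f => f
  | n + 1, _, _, f => Map.loopN n f.loop

/-- The `n`-fold loop space of an H-space is an H-space. -/
def HStructure.loopN : ∀ (n : ℕ) {X : PtdSpace.{u}}, HStructure X →
    HStructure (X.loopN n)
  | 0, _, H => H
  | n + 1, _, H => HStructure.loopN n H.loop

theorem Map.loopN_id (n : ℕ) (X : PtdSpace.{u}) : (Map.id X).loopN n = Map.id (X.loopN n) := by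
  induction n generalizing X with
  | zero => rfl
  | succ n ih => exact ih X.loop

theorem Map.loopN_comp (n : ℕ) {X : PtdSpace.{u}} {Y : PtdSpace.{v}} {Z : PtdSpace.{w}}
    (g : Map Y Z) (f : Map X Y) : (g.comp f).loopN n = (g.loopN n).comp (f.loopN n) := by
  induction n generalizing X Y Z with
  | zero => rfl
  | succ n ih => exact ih g.loop f.loop

theorem Map.loopN_zero (n : ℕ) (X : PtdSpace.{u}) (Y : PtdSpace.{v}) :
    (Map.zero X Y).loopN n = Map.zero (X.loopN n) (Y.loopN n) := by
  induction n generalizing X Y with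
  | zero => rfl
  | succ n ih => exact ih X.loop Y.loop

/-- An equality, not just a homotopy, because loop spaces carry the pointwise multiplication
inherited from the H-space rather than concatenation of loops. -/
theorem Map.loopN_add (n : ℕ) {X : PtdSpace.{u}} {Y : PtdSpace.{v}} (H : HStructure Y)
    (f g : Map X Y) : (Map.add H f g).loopN n = Map.add (H.loopN n) (f.loopN n) (g.loopN n) := by
  induction n generalizing X Y with
  | zero => rfl
  | succ n ih => exact ih H.loop f.loop g.loop

theorem Map.Homotopic.loopN (n : ℕ) {X : PtdSpace.{u}} {Y : PtdSpace.{v}} {f g : Map X Y}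
    (h : f.Homotopic g) : (f.loopN n).Homotopic (g.loopN n) := by
  induction n generalizing X Y with
  | zero => exact h
  | succ n ih => exact ih h.loop

/-! ### Fundamental groups of pointed spaces -/

/-- The fundamental group of a pointed space. -/
abbrev pi1 (X : PtdSpace.{u}) : Type u := FundamentalGroup X X.pt

/-- The class of a loop in the fundamental group. -/
def pi1.mk (γ : Path X.pt X.pt) : pi1 X := Path.Homotopic.Quotient.mk γ

theorem pi1.mk_surjective : Function.Surjective (pi1.mk : Path X.pt X.pt → pi1 X) :=
  Path.Homotopic.Quotient.mk_surjective

theorem pi1.mk_eq {γ δ : Path X.pt X.pt} : pi1.mk γ = pi1.mk δ ↔ γ.Homotopic δ :=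
  Path.Homotopic.Quotient.eq

theorem pi1.mk_mul (γ δ : Path X.pt X.pt) : pi1.mk γ * pi1.mk δ = pi1.mk (δ.trans γ) := rfl

theorem pi1.mk_one : pi1.mk (Path.refl X.pt) = 1 := rfl

/-- The homomorphism of fundamental groups induced by a pointed map. -/
def Map.pi1 (f : Map X Y) : pi1 X →* pi1 Y := FundamentalGroup.mapOfEq f.1 f.2

theorem Map.pi1_mk (f : Map X Y) (γ : Path X.pt X.pt) :
    f.pi1 (pi1.mk γ) = pi1.mk (f.mapLoop γ) :=
  FundamentalGroup.mapOfEq_apply f.1 f.2 _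

theorem Map.pi1_id : (Map.id X).pi1 = MonoidHom.id _ := by
  ext a
  obtain ⟨γ, rfl⟩ := pi1.mk_surjective a
  exact Map.pi1_mk _ _

theorem Map.pi1_comp (g : Map Y Z) (f : Map X Y) : (g.comp f).pi1 = g.pi1.comp f.pi1 := by
  ext a
  obtain ⟨γ, rfl⟩ := pi1.mk_surjective a
  simp only [MonoidHom.comp_apply, Map.pi1_mk]
  rfl

theorem Map.pi1_zero : (Map.zero X Y).pi1 = 1 := by
  ext a
  obtain ⟨γ, rfl⟩ := pi1.mk_surjective a
  exact Map.pi1_mk _ _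

theorem Map.Homotopic.pi1 {f g : Map X Y} (h : f.Homotopic g) : f.pi1 = g.pi1 := by
  ext a
  obtain ⟨γ, rfl⟩ := pi1.mk_surjective a
  rw [Map.pi1_mk, Map.pi1_mk, pi1.mk_eq]
  obtain ⟨F, hF, h0, h1, hp⟩ := Map.homotopic_iff.1 h
  refine ⟨⟨⟨⟨fun p => F (p.1, γ p.2), by fun_prop⟩, fun s => h0 _, fun s => h1 _⟩, ?_⟩⟩
  rintro s x (rfl | rfl)
  · simp [hp]
  · simp [hp]

/-- Eckmann–Hilton: pointwise multiplication and concatenation share a unit up to homotopy and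
satisfy the interchange law, so they agree on classes and both are commutative. Padding the two
loops with constant loops on opposite sides gives the two orders. -/
theorem HStructure.mk_loopMul (H : HStructure X) (γ δ : Path X.pt X.pt) :
    pi1.mk (H.loopMul γ δ) = pi1.mk γ * pi1.mk δ ∧
      pi1.mk (H.loopMul γ δ) = pi1.mk δ * pi1.mk γ := by
  have congr : ∀ {γ γ' δ δ' : Path X.pt X.pt}, γ.Homotopic γ' → δ.Homotopic δ' →
      pi1.mk (H.loopMul γ δ) = pi1.mk (H.loopMul γ' δ') := by
    rintro γ γ' δ δ' ⟨F⟩ ⟨G⟩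
    refine pi1.mk_eq.2 ⟨⟨⟨⟨fun p => H.toHSpace.hmul (F p, G p), by fun_prop⟩, ?_, ?_⟩, ?_⟩⟩
    · intro s; simp [loopMul]
    · intro s; simp [loopMul]
    · rintro s x (rfl | rfl) <;> simp [loopMul]
  have left : ∀ γ, pi1.mk (H.loopMul (Path.refl _) γ) = pi1.mk γ := fun γ => by
    have := DFunLike.congr_fun (H.zero_add_homotopic (Map.id X)).pi1 (pi1.mk γ)
    rwa [Map.pi1_mk, Map.pi1_mk] at this
  have right : ∀ γ, pi1.mk (H.loopMul γ (Path.refl _)) = pi1.mk γ := fun γ => by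
    have := DFunLike.congr_fun (H.add_zero_homotopic (Map.id X)).pi1 (pi1.mk γ)
    rwa [Map.pi1_mk, Map.pi1_mk] at this
  have exchange : ∀ γ γ' δ δ', H.loopMul (γ.trans γ') (δ.trans δ') =
      (H.loopMul γ δ).trans (H.loopMul γ' δ') := by
    intro γ γ' δ δ'
    ext s
    simp only [loopMul, Path.trans_apply, Path.coe_mk', ContinuousMap.coe_mk]
    split_ifs <;> rfl
  constructor
  · rw [congr (γ' := (Path.refl _).trans γ) (δ' := δ.trans (Path.refl _))
      ⟨(Path.Homotopy.reflTrans γ).symm⟩ ⟨(Path.Homotopy.transRefl δ).symm⟩, exchange,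
      ← pi1.mk_mul, left, right]
  · rw [congr (γ' := γ.trans (Path.refl _)) (δ' := (Path.refl _).trans δ)
      ⟨(Path.Homotopy.transRefl γ).symm⟩ ⟨(Path.Homotopy.reflTrans δ).symm⟩, exchange,
      ← pi1.mk_mul, left, right]

theorem HStructure.pi1_mul_comm (H : HStructure X) (a b : pi1 X) : a * b = b * a := by
  obtain ⟨γ, rfl⟩ := pi1.mk_surjective a
  obtain ⟨δ, rfl⟩ := pi1.mk_surjective b
  rw [← (H.mk_loopMul γ δ).1, (H.mk_loopMul γ δ).2]

theorem Map.pi1_add (H : HStructure Y) (f g : Map X Y) (a : X.pi1) :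
    (Map.add H f g).pi1 a = f.pi1 a * g.pi1 a := by
  obtain ⟨γ, rfl⟩ := pi1.mk_surjective a
  simp only [Map.pi1_mk]
  exact (H.mk_loopMul (f.mapLoop γ) (g.mapLoop γ)).1

/-! ### Homotopy groups -/

/-- All homotopy groups of positive degree of a pointed space, written additively. -/
def Pis (X : PtdSpace.{u}) : Type u := ∀ n : ℕ, Additive (X.loopN n).pi1

instance : AddGroup X.Pis := inferInstanceAs (AddGroup (∀ n : ℕ, Additive (X.loopN n).pi1))

/-- `X` admits an H-structure. -/
class IsH (X : PtdSpace.{u}) : Prop where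
  nonempty : Nonempty X.HStructure

instance [h : IsH X] : AddCommGroup X.Pis where
  add_comm a b := by
    obtain ⟨H⟩ := h.nonempty
    funext n
    exact (H.loopN n).pi1_mul_comm (a n) (b n)

/-- The homomorphism of homotopy groups induced by a pointed map. -/
def Map.pis (f : Map X Y) : X.Pis →+ Y.Pis where
  toFun a n := Additive.ofMul ((f.loopN n).pi1 (a n).toMul)
  map_zero' := funext fun n => (f.loopN n).pi1.map_one
  map_add' a b := funext fun n => (f.loopN n).pi1.map_mul (a n).toMul (b n).toMul

theorem Map.pis_apply (f : Map X Y) (a : X.Pis) (n : ℕ) :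
    f.pis a n = Additive.ofMul ((f.loopN n).pi1 (a n).toMul) := rfl

theorem Map.pis_id : (Map.id X).pis = AddMonoidHom.id _ := by
  ext a
  funext n
  rw [Map.pis_apply, Map.loopN_id, Map.pi1_id]
  rfl

theorem Map.pis_comp (g : Map Y Z) (f : Map X Y) : (g.comp f).pis = g.pis.comp f.pis := by
  ext a
  funext n
  rw [Map.pis_apply, Map.loopN_comp, Map.pi1_comp]
  rfl

theorem Map.pis_zero : (Map.zero X Y).pis = 0 := by
  ext a
  funext n
  rw [Map.pis_apply, Map.loopN_zero, Map.pi1_zero]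
  rfl

theorem Map.Homotopic.pis {f g : Map X Y} (h : f.Homotopic g) : f.pis = g.pis := by
  ext a
  funext n
  rw [Map.pis_apply, (h.loopN n).pi1]
  rfl

/-- The linearization on which everything rests: no associativity or inverses in the H-structure are
needed for the sum to become addition in an abelian group. -/
theorem Map.pis_add [IsH Y] (H : HStructure Y) (f g : Map X Y) :
    (Map.add H f g).pis = f.pis + g.pis := by
  ext a
  funext n
  rw [Map.pis_apply, Map.loopN_add, Map.pi1_add]
  rfl

/-- The element of the homotopy groups with a single component. -/
def Pis.single (n : ℕ) (a : (X.loopN n).pi1) : X.Pis :=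
  fun m => if e : m = n then e ▸ Additive.ofMul a else 0

theorem Pis.single_same (n : ℕ) (a : (X.loopN n).pi1) : Pis.single n a n = Additive.ofMul a :=
  dif_pos rfl

theorem Map.pis_single (f : Map X Y) (n : ℕ) (a : (X.loopN n).pi1) :
    f.pis (Pis.single n a) = Pis.single n ((f.loopN n).pi1 a) := by
  funext m
  rw [Map.pis_apply]
  by_cases e : m = n
  · subst e
    rw [Pis.single_same, Pis.single_same]
    rfl
  · rw [show Pis.single n a m = 0 from dif_neg e,
      show Pis.single n ((f.loopN n).pi1 a) m = 0 from dif_neg e]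
    exact (f.loopN m).pi1.map_one

theorem Map.pis_bijective_iff (f : Map X Y) :
    Function.Bijective f.pis ↔ ∀ n, Function.Bijective (f.loopN n).pi1 := by
  constructor
  · intro h n
    refine ⟨fun a b hab => ?_, fun b => ?_⟩
    · have h' := @h.1 (Pis.single n a) (Pis.single n b) (by
        rw [Map.pis_single, Map.pis_single, hab])
      have h'' := congrFun h' n
      rwa [Pis.single_same, Pis.single_same] at h''
    · obtain ⟨a, ha⟩ := h.2 (Pis.single n b)
      refine ⟨(a n).toMul, ?_⟩
      have := congrFun ha n
      rwa [Pis.single_same] at this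
  · intro h
    refine ⟨fun a b hab => ?_, fun b => ?_⟩
    · funext n
      exact (h n).1 (congrFun hab n)
    · choose a ha using fun n => (h n).2 (b n).toMul
      exact ⟨fun n => Additive.ofMul (a n), funext fun n => ha n⟩

end

end PtdSpace

namespace PtdSpace

open scoped unitInterval

noncomputable section

variable {A : PtdSpace.{u}} {B : PtdSpace.{v}}

/-! ### Homotopy fibres -/

/-- The homotopy fibre of a pointed map. -/
def hfib (f : Map A B) : PtdSpace.{max u v} where
  carrier := {p : A × C(I, B) // p.2 0 = f.1 p.1 ∧ p.2 1 = B.pt}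
  pt := ⟨(A.pt, ContinuousMap.const I B.pt), f.2.symm, rfl⟩

/-- A point of the homotopy fibre, from a point of the source and a path. -/
def hfib.mk (f : Map A B) (a : A) (γ : C(I, B)) (h0 : γ 0 = f.1 a) (h1 : γ 1 = B.pt) : hfib f :=
  ⟨(a, γ), h0, h1⟩

/-- The underlying point of a point of the homotopy fibre. -/
def hfib.fst {f : Map A B} (z : hfib f) : A := z.1.1

/-- The path of a point of the homotopy fibre. -/
def hfib.snd {f : Map A B} (z : hfib f) : C(I, B) := z.1.2

theorem hfib.snd_zero {f : Map A B} (z : hfib f) : hfib.snd z 0 = f.1 (hfib.fst z) := z.2.1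

theorem hfib.snd_one {f : Map A B} (z : hfib f) : hfib.snd z 1 = B.pt := z.2.2

@[continuity, fun_prop]
theorem hfib.continuous_fst {f : Map A B} : Continuous (hfib.fst : hfib f → A) :=
  _root_.continuous_fst.comp continuous_subtype_val

@[continuity, fun_prop]
theorem hfib.continuous_snd {f : Map A B} : Continuous (hfib.snd : hfib f → C(I, B)) :=
  _root_.continuous_snd.comp continuous_subtype_val

theorem hfib.continuous_mk {f : Map A B} {T : Type*} [TopologicalSpace T] {a : T → A}
    {γ : T → C(I, B)} (h0 : ∀ x, γ x 0 = f.1 (a x)) (h1 : ∀ x, γ x 1 = B.pt)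
    (ha : Continuous a) (hγ : Continuous fun p : T × I => γ p.1 p.2) :
    Continuous fun x => hfib.mk f (a x) (γ x) (h0 x) (h1 x) :=
  (ha.prodMk (ContinuousMap.continuous_of_continuous_uncurry γ hγ)).subtype_mk _

theorem hfib.ext {f : Map A B} {z z' : hfib f} (h : hfib.fst z = hfib.fst z')
    (h' : ∀ s, hfib.snd z s = hfib.snd z' s) : z = z' :=
  Subtype.ext (Prod.ext h (ContinuousMap.ext h'))

/-- The tail π₁(A) → π₁(B) → π₀(fibre) → π₀(A) → π₀(B) of the exact sequence: the point can be moved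
to the base point in A, and the loop in B left over is the image of a loop in A up to homotopy. -/
theorem hfib.joined_pt (f : Map A B) (inj : ∀ a, Joined (f.1 a) B.pt → Joined a A.pt)
    (surj : Function.Surjective f.pi1) (z : hfib f) : Joined z (hfib f).pt := by
  let γ : Path (f.1 (hfib.fst z)) B.pt := ⟨hfib.snd z, hfib.snd_zero z, hfib.snd_one z⟩
  obtain ⟨N⟩ := inj _ ⟨γ⟩
  let fN : Path (f.1 (hfib.fst z)) B.pt := (N.map f.1.continuous).cast rfl f.2.symm
  obtain ⟨b, hb⟩ := surj (pi1.mk (fN.symm.trans γ))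
  obtain ⟨β, rfl⟩ := pi1.mk_surjective b
  rw [Map.pi1_mk, pi1.mk_eq] at hb
  -- The path N followed by the correcting loop β has image homotopic to γ relative to the end
  -- points.
  let M : Path (f.1 (hfib.fst z)) B.pt := ((N.trans β).map f.1.continuous).cast rfl f.2.symm
  have hM : M = fN.trans (f.mapLoop β) := by
    ext s
    simp only [M, fN, Path.cast_coe, Path.map_coe, Function.comp, Path.trans_apply]
    split_ifs <;> rfl
  have hG : γ.Homotopic M := by
    rw [hM]
    refine Path.Homotopic.symm (((Path.Homotopic.refl fN).hcomp hb).trans ?_)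
    refine Path.Homotopic.trans ⟨(Path.Homotopy.transAssoc fN fN.symm γ).symm⟩ ?_
    refine Path.Homotopic.trans
      (Path.Homotopic.hcomp ⟨(Path.Homotopy.reflTransSymm fN).symm⟩ (Path.Homotopic.refl γ)) ?_
    exact ⟨Path.Homotopy.reflTrans γ⟩
  obtain ⟨G⟩ := hG
  have hMs : ∀ s, M s = f.1 ((N.trans β) s) := fun s => rfl
  have h₁ : Joined z (hfib.mk f (hfib.fst z) M.toContinuousMap M.source M.target) := by
    refine ⟨⟨⟨fun s => hfib.mk f (hfib.fst z) (G.eval s).toContinuousMap (G.eval s).source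
      (G.eval s).target, ?_⟩, ?_, ?_⟩⟩
    · refine hfib.continuous_mk _ _ continuous_const ?_
      exact G.continuous
    · refine hfib.ext rfl fun s => ?_
      change G (0, s) = _
      simp; rfl
    · refine hfib.ext rfl fun s => ?_
      change G (1, s) = _
      simp; rfl
  -- The point slides along N·β while its path is shortened to the part of M after time s.
  refine h₁.trans ⟨⟨⟨fun s => hfib.mk f ((N.trans β) s)
    ⟨fun r => M (s ⊔ r), by fun_prop⟩ ?_ ?_, ?_⟩, ?_, ?_⟩⟩
  · exact (congrArg M (sup_of_le_left s.2.1)).trans (hMs s)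
  · exact (congrArg M (sup_of_le_right s.2.2)).trans M.target
  · refine hfib.continuous_mk _ _ (by fun_prop) ?_
    simp only [ContinuousMap.coe_mk]
    fun_prop
  · refine hfib.ext (N.trans β).source fun s => ?_
    exact congrArg M (sup_of_le_right s.2.1)
  · refine hfib.ext (N.trans β).target fun s => ?_
    exact (congrArg M (sup_of_le_left s.2.2)).trans M.target

/-- Loops in the homotopy fibre, as points of the homotopy fibre of the loop map. -/
def hfib.ofLoop (f : Map A B) : Map (hfib f).loop (hfib f.loop) where
  val :=
    { toFun := fun ω => hfib.mk f.loop
        (⟨⟨fun s => hfib.fst (loopPath ω s), by fun_prop⟩,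
          congrArg hfib.fst (loopPath ω).source,
          congrArg hfib.fst (loopPath ω).target⟩ : Path A.pt A.pt)
        ⟨fun r => (⟨⟨fun s => hfib.snd (loopPath ω s) r, by fun_prop⟩,
          congrArg (fun z => hfib.snd z r) (loopPath ω).source,
          congrArg (fun z => hfib.snd z r) (loopPath ω).target⟩ : Path B.pt B.pt),
          continuous_to_loop (by
            change Continuous fun p : I × I => hfib.snd (loopPath ω p.2) p.1
            fun_prop)⟩
        (Path.ext (funext fun s => hfib.snd_zero (loopPath ω s)))
        (Path.ext (funext fun s => hfib.snd_one (loopPath ω s)))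
      continuous_toFun := by
        refine hfib.continuous_mk _ _ (continuous_to_loop ?_) (continuous_to_loop ?_)
        · exact hfib.continuous_fst.comp continuous_loop_apply
        · have h : Continuous fun p : ((hfib f).loop × I) × I => loopPath p.1.1 p.2 :=
            continuous_loop_apply.comp (by fun_prop : Continuous fun p :
              ((hfib f).loop × I) × I => (p.1.1, p.2))
          change Continuous fun p : ((hfib f).loop × I) × I =>
            hfib.snd (loopPath p.1.1 p.2) p.1.2
          fun_prop }
  property := rfl

/-- Points of the homotopy fibre of a loop map, as loops in the homotopy fibre. -/
def hfib.toLoop (f : Map A B) : Map (hfib f.loop) (hfib f).loop where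
  val :=
    { toFun := fun z => (⟨⟨fun s => hfib.mk f (loopPath (hfib.fst z) s)
          ⟨fun r => loopPath (hfib.snd z r) s, by
            exact continuous_loop_apply.comp (by fun_prop :
              Continuous fun r : I => (hfib.snd z r, s))⟩
          (by
            have := hfib.snd_zero z
            exact congrArg (fun γ => loopPath γ s) this)
          (by
            have := hfib.snd_one z
            exact congrArg (fun γ => loopPath γ s) this),
          by
            refine hfib.continuous_mk _ _ (by fun_prop) ?_
            exact continuous_loop_apply.comp (by fun_prop :
              Continuous fun p : I × I => (hfib.snd z p.2, p.1))⟩,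
          hfib.ext (loopPath (hfib.fst z)).source fun r => (loopPath (hfib.snd z r)).source,
          hfib.ext (loopPath (hfib.fst z)).target fun r => (loopPath (hfib.snd z r)).target⟩ :
          Path (hfib f).pt (hfib f).pt)
      continuous_toFun := by
        refine continuous_to_loop (hfib.continuous_mk
          (fun p => congrArg (fun γ => loopPath γ p.2) (hfib.snd_zero p.1))
          (fun p => congrArg (fun γ => loopPath γ p.2) (hfib.snd_one p.1)) ?_ ?_)
        · exact continuous_loop_apply.comp (by fun_prop :
            Continuous fun p : hfib f.loop × I => (hfib.fst p.1, p.2))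
        · exact continuous_loop_apply.comp (by fun_prop :
            Continuous fun p : (hfib f.loop × I) × I => (hfib.snd p.1.1 p.2, p.1.2)) }
  property := rfl

/-- Swapping the two path parameters identifies loops in the fibre with the fibre of the looped map.
This one composite suffices to transfer connectedness. -/
theorem hfib.toLoop_comp_ofLoop (f : Map A B) :
    (hfib.toLoop f).comp (hfib.ofLoop f) = Map.id _ := rfl

/-- A space all of whose iterated loop spaces are path-connected. -/
def WeaklyTrivial (W : PtdSpace.{u}) : Prop := ∀ (k : ℕ) (z : W.loopN k), Joined z (W.loopN k).pt

theorem WeaklyTrivial.loop {W : PtdSpace.{u}} (h : W.WeaklyTrivial) : W.loop.WeaklyTrivial :=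
  fun k => h (k + 1)

/-- Weak equivalences at the base point. -/
def Map.IsWeq (f : Map A B) : Prop :=
  ∀ k : ℕ, (∀ a, Joined ((f.loopN k).1 a) (B.loopN k).pt → Joined a (A.loopN k).pt) ∧
    Function.Surjective (f.loopN k).pi1

/-- Looping f reduces the (k+1)-st loop space of its fibre to the k-th loop space of the fibre of
`f.loop`, so only `hfib.joined_pt` is ever used. -/
theorem Map.IsWeq.hfib {f : Map A B} (h : f.IsWeq) : (hfib f).WeaklyTrivial := by
  intro k
  induction k generalizing A B with
  | zero => exact hfib.joined_pt f (h 0).1 (h 0).2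
  | succ k ih =>
    intro z
    have h' : f.loop.IsWeq := fun j => h (j + 1)
    have hz : ((hfib.toLoop f).loopN k).1 (((hfib.ofLoop f).loopN k).1 z) = z := by
      have e : ((hfib.toLoop f).loopN k).comp ((hfib.ofLoop f).loopN k) = Map.id _ := by
        rw [← Map.loopN_comp, hfib.toLoop_comp_ofLoop, Map.loopN_id]
      exact congrArg (fun m : Map _ _ => m.1 z) e
    obtain ⟨p⟩ := ih h' (((hfib.ofLoop f).loopN k).1 z)
    exact ⟨(p.map ((hfib.toLoop f).loopN k).1.continuous).cast hz.symm
      ((hfib.toLoop f).loopN k).2.symm⟩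

theorem pi1.mk_eq_one_iff_joined {γ : Path A.pt A.pt} :
    pi1.mk γ = 1 ↔ Joined (ofPath γ) A.loop.pt := by
  rw [← pi1.mk_one, pi1.mk_eq]
  constructor
  · rintro ⟨G⟩
    exact ⟨⟨⟨G.eval, continuous_to_loop G.continuous⟩, G.eval_zero, G.eval_one⟩⟩
  · rintro ⟨p⟩
    have hs : loopPath (p 0) = γ := p.source
    have ht : loopPath (p 1) = Path.refl A.pt := p.target
    refine ⟨⟨⟨⟨fun q => loopPath (p q.1) q.2, ?_⟩, ?_, ?_⟩, ?_⟩⟩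
    · exact continuous_loop_apply.comp (by fun_prop : Continuous fun q : I × I => (p q.1, q.2))
    · intro s; exact congrArg (fun δ : Path A.pt A.pt => δ s) hs
    · intro s; exact congrArg (fun δ : Path A.pt A.pt => δ s) ht
    · rintro s x (rfl | rfl)
      · exact (loopPath (p s)).source.trans γ.source.symm
      · exact (loopPath (p s)).target.trans γ.target.symm

/-- Path components of a loop space are elements of π₁ one level down. This converts π₁ data into
the π₀ condition of `IsWeq` at every level but the lowest, where path-connectedness is used instead.
-/
theorem Map.joined_of_pi1_injective (k : ℕ) {A : PtdSpace.{u}} {B : PtdSpace.{v}} (f : Map A B)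
    (h : Function.Injective (f.loopN k).pi1) (a : A.loopN (k + 1))
    (ha : Joined ((f.loopN (k + 1)).1 a) (B.loopN (k + 1)).pt) :
    Joined a (A.loopN (k + 1)).pt := by
  induction k generalizing A B with
  | zero =>
    let γ : Path A.pt A.pt := loopPath (X := A) a
    have h₁ : f.pi1 (pi1.mk γ) = f.pi1 1 := by
      rw [Map.pi1_mk, map_one]
      exact pi1.mk_eq_one_iff_joined.2 ha
    exact pi1.mk_eq_one_iff_joined.1 (h h₁)
  | succ k ih => exact ih f.loop h a ha

theorem Map.isWeq_of_bijective [PathConnectedSpace A] (f : Map A B)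
    (h : Function.Bijective f.pis) : f.IsWeq := by
  rw [Map.pis_bijective_iff] at h
  intro k
  refine ⟨?_, (h k).2⟩
  cases k with
  | zero => exact fun a _ => PathConnectedSpace.joined (X := A) a A.pt
  | succ k => exact f.joined_of_pi1_injective k (h k).1

end

end PtdSpace

section CellularLifting

open scoped unitInterval

open Metric Set

/-! ### Extending maps from spheres to balls -/

/-- A continuous map from a compact set to a Hausdorff space is closed, hence a quotient map onto
its image. -/
theorem ContinuousOn.of_comp_isCompact {P Q W : Type*} [TopologicalSpace P] [TopologicalSpace Q]
    [TopologicalSpace W] [T2Space Q] {T : Set P} (hT : IsCompact T) {q : P → Q}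
    (hq : ContinuousOn q T) {φ : Q → W} (h : ContinuousOn (φ ∘ q) T) :
    ContinuousOn φ (q '' T) := by
  rw [continuousOn_iff_isClosed] at h ⊢
  intro C hC
  obtain ⟨U, hU, hUT⟩ := h C hC
  have hc : IsCompact (q '' (U ∩ T)) := (hT.inter_left hU).image_of_continuousOn
    (hq.mono inter_subset_right)
  refine ⟨q '' (U ∩ T), hc.isClosed, ?_⟩
  rw [← hUT]
  ext y
  constructor
  · rintro ⟨hy, x, hx, rfl⟩
    exact ⟨⟨x, ⟨hy, hx⟩, rfl⟩, x, hx, rfl⟩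
  · rintro ⟨⟨x, ⟨hy, hx⟩, rfl⟩, h'⟩
    exact ⟨hy, h'⟩

theorem Fin.norm_eq_max_tail {n : ℕ} (x : Fin (n + 1) → ℝ) :
    ‖x‖ = max |x 0| ‖fun i : Fin n => x i.succ‖ := by
  apply le_antisymm
  · rw [pi_norm_le_iff_of_nonneg (by positivity)]
    intro i
    refine Fin.cases (le_max_left _ _) (fun j => ?_) i
    exact (norm_le_pi_norm (fun i : Fin n => x i.succ) j).trans (le_max_right _ _)
  · refine max_le (norm_le_pi_norm x 0) ?_
    rw [pi_norm_le_iff_of_nonneg (by positivity)]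
    exact fun j => norm_le_pi_norm x j.succ

namespace PtdSpace

noncomputable section

variable {A : PtdSpace.{u}} {B : PtdSpace.{v}}

/-- In the sup norm the ball is a cube, so the first coordinate can serve as a loop parameter: a map
trivial outside the (n+1)-cube is a map into the loop space trivial outside the n-cube. -/
theorem WeaklyTrivial.exists_nullhomotopy (n : ℕ) {W : PtdSpace.{u}} (hW : W.WeaklyTrivial)
    (φ : (Fin n → ℝ) → W) (hφ : Continuous φ) (h1 : ∀ x, 1 ≤ ‖x‖ → φ x = W.pt) :
    ∃ H : (Fin n → ℝ) × ℝ → W, Continuous H ∧ (∀ x, H (x, 0) = φ x) ∧ (∀ x, H (x, 1) = W.pt) ∧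
      ∀ x s, 1 ≤ ‖x‖ → H (x, s) = W.pt := by
  induction n generalizing W with
  | zero =>
    obtain ⟨p⟩ := hW 0 (φ 0)
    let p' : Path (φ 0) W.pt := p
    refine ⟨fun q => p'.extend q.2, by fun_prop, fun x => ?_, fun x => ?_, fun x s hx => ?_⟩
    · rw [Subsingleton.elim x 0]; exact p'.extend_zero
    · exact p'.extend_one
    · rw [Subsingleton.elim x 0, norm_zero] at hx
      linarith
  | succ n ih =>
    have hbd : ∀ (r : ℝ) (x : Fin n → ℝ), (1 ≤ |r| ∨ 1 ≤ ‖x‖) →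
        φ (Fin.cons r x) = W.pt := fun r x h => h1 _ <| by
      rw [Fin.norm_eq_max_tail]
      simpa using h
    have hc : Continuous fun p : (Fin n → ℝ) × I => φ (Fin.cons (2 * (p.2 : ℝ) - 1) p.1) := by
      refine hφ.comp ?_
      refine continuous_pi fun i => Fin.cases ?_ (fun j => ?_) i
      · simp only [Fin.cons_zero]; fun_prop
      · simp only [Fin.cons_succ]; fun_prop
    -- The substitution 2s - 1 carries the loop parameter from [0, 1] to the side [-1, 1] of the
    -- cube.
    let ψ : (Fin n → ℝ) → W.loop := fun x => ofPath
      ⟨⟨fun s => φ (Fin.cons (2 * (s : ℝ) - 1) x), hc.comp (by fun_prop :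
        Continuous fun s : I => (x, s))⟩, hbd _ _ (by norm_num), hbd _ _ (by norm_num)⟩
    obtain ⟨H, hH, H0, H1, Hb⟩ := ih hW.loop ψ (continuous_to_loop hc) fun x hx =>
      Path.ext (funext fun s => hbd _ _ (Or.inr hx))
    refine ⟨fun q => loopPath (H (fun i => q.1 i.succ, q.2))
      (projIcc 0 1 zero_le_one ((q.1 0 + 1) / 2)), ?_, fun x => ?_, fun x => ?_, fun x s hx => ?_⟩
    · exact continuous_loop_apply.comp (by fun_prop : Continuous fun q : (Fin (n + 1) → ℝ) × ℝ =>
        (H (fun i => q.1 i.succ, q.2), projIcc 0 1 zero_le_one ((q.1 0 + 1) / 2)))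
    · change loopPath (H (fun i => x i.succ, 0)) _ = _
      rw [H0]
      change φ (Fin.cons (2 * ((projIcc 0 1 zero_le_one ((x 0 + 1) / 2) : I) : ℝ) - 1) _) = _
      rw [coe_projIcc]
      by_cases hx : 1 ≤ |x 0|
      · rw [h1 x (hx.trans (norm_le_pi_norm x 0)), hbd]
        left
        rcases le_abs.1 hx with hx | hx
        · rw [min_eq_left (by linarith)]; norm_num
        · rw [max_eq_left ((min_le_right _ _).trans (by linarith))]; norm_num
      · obtain ⟨h2, h3⟩ := abs_lt.1 (not_le.1 hx)
        rw [min_eq_right (by linarith), max_eq_right (by linarith)]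
        congr 1
        refine funext fun i => Fin.cases ?_ (fun j => rfl) i
        simp only [Fin.cons_zero]; ring
    · change loopPath (H (fun i => x i.succ, 1)) _ = _
      rw [H1]; rfl
    · rw [Fin.norm_eq_max_tail] at hx
      rcases le_max_iff.1 hx with hx | hx
      · rcases le_abs.1 hx with hx | hx
        · have e := projIcc_of_right_le zero_le_one (show 1 ≤ (x 0 + 1) / 2 by linarith)
          exact (congrArg _ e).trans (loopPath _).target
        · have e := projIcc_of_le_left zero_le_one (show (x 0 + 1) / 2 ≤ 0 by linarith)
          exact (congrArg _ e).trans (loopPath _).source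
      · change loopPath (H (fun i => x i.succ, s)) _ = _
        rw [Hb _ _ hx]; rfl

/-- Null-homotopy with the complement of the ball moving along a path. -/
theorem WeaklyTrivial.exists_free_nullhomotopy (n : ℕ) {W : PtdSpace.{u}} (hW : W.WeaklyTrivial)
    (φ : (Fin n → ℝ) → W) (hφ : Continuous φ) (c : W) (h1 : ∀ x, 1 ≤ ‖x‖ → φ x = c) :
    ∃ H : (Fin n → ℝ) × ℝ → W, Continuous H ∧ (∀ x, H (x, 0) = φ x) ∧ (∀ x, H (x, 1) = W.pt) ∧
      ∀ x y s, 1 ≤ ‖x‖ → 1 ≤ ‖y‖ → H (x, s) = H (y, s) := by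
  obtain ⟨p⟩ := hW 0 c
  let ω : Path c W.pt := p
  -- At time s the map φ is squeezed into the ball of radius 1/(1+s) and the surrounding collar runs
  -- along ω, with value ω(s) from radius 1 on. At time 1 the map is trivial outside the unit ball,
  -- so the based null-homotopy applies.
  let G : (Fin n → ℝ) × ℝ → W := fun q =>
    if (1 + q.2) * ‖q.1‖ ≤ 1 then φ ((1 + q.2) • q.1)
      else ω.extend (min ((1 + q.2) * ‖q.1‖ - 1) q.2)
  have key : ∀ (x : Fin n → ℝ) (s : ℝ), 0 ≤ s → (1 + s) * ‖x‖ = 1 → φ ((1 + s) • x) = c := by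
    intro x s hs hx
    refine h1 _ ?_
    rw [norm_smul, Real.norm_eq_abs, abs_of_nonneg (by linarith), hx]
  have hG : ContinuousOn G (univ ×ˢ Ici 0) := by
    rw [continuousOn_iff_continuous_domRestrict]
    refine Continuous.if_le (by fun_prop) (by fun_prop) (by fun_prop) (by fun_prop) ?_
    rintro ⟨⟨x, s⟩, hxs⟩ hx
    have hs : 0 ≤ s := hxs.2
    replace hx : (1 + s) * ‖x‖ = 1 := hx
    change φ ((1 + s) • x) = ω.extend (min ((1 + s) * ‖x‖ - 1) s)
    rw [key x s hs hx, hx, sub_self, min_eq_left hs, ω.extend_zero]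
  have hG0 : ∀ x, G (x, 0) = φ x := by
    intro x
    simp only [G, add_zero, one_mul, one_smul]
    split_ifs with h
    · rfl
    · rw [h1 x (not_le.1 h).le, min_eq_right (by linarith), ω.extend_zero]
  have hGb : ∀ x s, 0 ≤ s → 1 ≤ ‖x‖ → G (x, s) = ω.extend s := by
    intro x s hs hx
    simp only [G]
    have hxs : 1 + s ≤ (1 + s) * ‖x‖ := le_mul_of_one_le_right (by linarith) hx
    split_ifs with h
    · have hs0 : s = 0 := by linarith
      subst hs0
      rw [ω.extend_zero]
      exact key x 0 le_rfl (le_antisymm h (by linarith))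
    · rw [min_eq_right (by linarith)]
  have hG' : Continuous fun q : (Fin n → ℝ) × ℝ => G (q.1, max q.2 0) :=
    hG.comp_continuous (by fun_prop) fun q => ⟨trivial, mem_Ici.2 (le_max_right _ _)⟩
  obtain ⟨K, hK, K0, K1, Kb⟩ := hW.exists_nullhomotopy n (fun x => G (x, 1))
    (by simpa [Function.comp_def] using
      hG'.comp (by fun_prop : Continuous fun x : Fin n → ℝ => (x, (1 : ℝ))))
    (fun x hx => (hGb x 1 zero_le_one hx).trans ω.extend_one)
  refine ⟨fun q => if q.2 ≤ 1 / 2 then G (q.1, max (2 * q.2) 0) else K (q.1, 2 * q.2 - 1), ?_,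
    fun x => ?_, fun x => ?_, fun x y s hx hy => ?_⟩
  · refine Continuous.if_le (hG'.comp (by fun_prop : Continuous fun q : (Fin n → ℝ) × ℝ =>
      (q.1, 2 * q.2))) (by fun_prop) (by fun_prop) (by fun_prop) ?_
    intro q hq
    rw [hq]
    norm_num
    exact (K0 _).symm
  · simp [hG0]
  · norm_num
    exact K1 x
  · simp only
    split_ifs
    · rw [hGb _ _ (le_max_right _ _) hx, hGb _ _ (le_max_right _ _) hy]
    · rw [Kb _ _ hx, Kb _ _ hy]

end

end PtdSpace

/-! ### Suspension coordinates on a ball -/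

section Suspension

variable {n : ℕ}

/-- A nowhere vanishing map, whose normalization collapses the complement of the open unit ball. -/
noncomputable def collapseVec (x : Fin n → ℝ) : Fin (n + 1) → ℝ :=
  Fin.cons (1 - 2 * min ‖x‖ 1) ((1 - min ‖x‖ 1) • x)

theorem continuous_collapseVec : Continuous (collapseVec : (Fin n → ℝ) → Fin (n + 1) → ℝ) := by
  refine continuous_pi fun i => Fin.cases ?_ (fun j => ?_) i
  · simp only [collapseVec, Fin.cons_zero]; fun_prop
  · simp only [collapseVec, Fin.cons_succ]; fun_prop

theorem collapseVec_ne_zero (x : Fin n → ℝ) : collapseVec x ≠ 0 := by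
  intro h
  have h0 : 1 - 2 * min ‖x‖ 1 = 0 := congrFun h 0
  have h1 : (1 - min ‖x‖ 1) • x = 0 := funext fun i => congrFun h i.succ
  have hm : min ‖x‖ 1 = 1 / 2 := by linarith
  rw [hm] at h1
  have hx : x = 0 := by
    refine (smul_eq_zero.1 h1).resolve_left (by norm_num)
  rw [hx] at hm
  norm_num at hm

/-- The map from the ball to the sphere collapsing the boundary to a point. -/
noncomputable def collapse (x : Fin n → ℝ) : Fin (n + 1) → ℝ :=
  ‖collapseVec x‖⁻¹ • collapseVec x

theorem continuous_collapse : Continuous (collapse : (Fin n → ℝ) → Fin (n + 1) → ℝ) :=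
  (continuous_collapseVec.norm.inv₀ fun x => norm_ne_zero_iff.2 (collapseVec_ne_zero x)).smul
    continuous_collapseVec

theorem norm_collapse (x : Fin n → ℝ) : ‖collapse x‖ = 1 :=
  norm_smul_inv_norm' (𝕜 := ℝ) (r := 1) zero_le_one (collapseVec_ne_zero x) |> fun h => by
    simpa [collapse] using h

theorem collapseVec_of_one_le {x : Fin n → ℝ} (hx : 1 ≤ ‖x‖) :
    collapseVec x = Fin.cons (-1) 0 := by
  rw [collapseVec, min_eq_right hx]
  norm_num

theorem collapse_of_one_le {x y : Fin n → ℝ} (hx : 1 ≤ ‖x‖) (hy : 1 ≤ ‖y‖) :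
    collapse x = collapse y := by
  rw [collapse, collapse, collapseVec_of_one_le hx, collapseVec_of_one_le hy]

/-- Collinearity of the two vectors, after taking norms, leaves two scalar equations in the
truncated norms r, s and the ratio l > 0; these force r = s, and then l = 1 away from the boundary.
-/
theorem eq_or_of_collapse_eq {x y : Fin n → ℝ} (h : collapse x = collapse y) :
    x = y ∨ (1 ≤ ‖x‖ ∧ 1 ≤ ‖y‖) := by
  have px := norm_pos_iff.2 (collapseVec_ne_zero x)
  have py := norm_pos_iff.2 (collapseVec_ne_zero y)
  set l := ‖collapseVec x‖ * ‖collapseVec y‖⁻¹ with hl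
  have lpos : 0 < l := by positivity
  have hv : collapseVec x = l • collapseVec y := by
    have := congrArg (fun z => ‖collapseVec x‖ • z) h
    simp only [collapse, smul_smul] at this
    rwa [mul_inv_cancel₀ px.ne', one_smul] at this
  have h0 : 1 - 2 * min ‖x‖ 1 = l * (1 - 2 * min ‖y‖ 1) := congrFun hv 0
  have h1 : (1 - min ‖x‖ 1) • x = l • ((1 - min ‖y‖ 1) • y) := funext fun i => congrFun hv i.succ
  have hn : (1 - min ‖x‖ 1) * ‖x‖ = l * ((1 - min ‖y‖ 1) * ‖y‖) := by
    have := congrArg norm h1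
    rwa [norm_smul, norm_smul, norm_smul, Real.norm_of_nonneg lpos.le,
      Real.norm_of_nonneg (by linarith [min_le_right ‖x‖ 1]),
      Real.norm_of_nonneg (by linarith [min_le_right ‖y‖ 1])] at this
  have hm : ∀ z : Fin n → ℝ, (1 - min ‖z‖ 1) * ‖z‖ = (1 - min ‖z‖ 1) * min ‖z‖ 1 := by
    intro z
    rcases le_total ‖z‖ 1 with hz | hz
    · rw [min_eq_left hz]
    · rw [min_eq_right hz]; ring
  rw [hm, hm] at hn
  have hr0 : 0 ≤ min ‖x‖ 1 := by positivity
  have hr1 : min ‖x‖ 1 ≤ 1 := min_le_right _ _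
  have hs0 : 0 ≤ min ‖y‖ 1 := by positivity
  have hs1 : min ‖y‖ 1 ≤ 1 := min_le_right _ _
  have hx1 : min ‖x‖ 1 = 1 → 1 ≤ ‖x‖ := fun h => min_eq_right_iff.1 h
  have hy1 : min ‖y‖ 1 = 1 → 1 ≤ ‖y‖ := fun h => min_eq_right_iff.1 h
  generalize min ‖x‖ 1 = r at *
  generalize min ‖y‖ 1 = s at *
  -- Eliminating the ratio between the two equations. On the unit square the last factor vanishes
  -- only at the corners (0, 1) and (1, 0), where `h0` would give l = -1.
  have hcross : l * ((s - r) * ((1 - s) * (1 - r) + r * s)) = 0 := by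
    linear_combination (l * (1 - s) * s) * h0 - (l * (1 - 2 * s)) * hn
  have hrs : r = s := by
    rcases mul_eq_zero.1 ((mul_eq_zero.1 hcross).resolve_left lpos.ne') with h | h
    · linarith
    · have h2 : (1 - s) * (1 - r) = 0 := by nlinarith [mul_nonneg hr0 hs0]
      have h3 : r * s = 0 := by nlinarith [mul_nonneg hr0 hs0]
      rcases mul_eq_zero.1 h2 with h2 | h2 <;> rcases mul_eq_zero.1 h3 with h3 | h3
      · exfalso
        rw [show s = 1 by linarith, h3] at h0
        linarith
      · linarith
      · linarith
      · exfalso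
        rw [show r = 1 by linarith, h3] at h0
        linarith
  subst hrs
  by_cases hr : r = 1
  · exact Or.inr ⟨hx1 hr, hy1 hr⟩
  · left
    have hl1 : l = 1 := by
      by_cases hh : r = 1 / 2
      · rw [hh] at hn; linarith
      · have : (1 - l) * (1 - 2 * r) = 0 := by linarith
        rcases mul_eq_zero.1 this with h | h
        · linarith
        · exact absurd (by linarith) hh
    rw [hl1, one_smul] at h1
    exact smul_right_injective _ (sub_ne_zero.2 (Ne.symm hr)) h1

theorem exists_collapse_eq (hn : 0 < n) (y : Fin (n + 1) → ℝ) (hy : ‖y‖ = 1) :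
    ∃ x : Fin n → ℝ, ‖x‖ ≤ 1 ∧ collapse x = y := by
  suffices h : ∃ x : Fin n → ℝ, ‖x‖ ≤ 1 ∧ ∃ c : ℝ, 0 < c ∧ collapseVec x = c • y by
    obtain ⟨x, hx, c, hc, hxy⟩ := h
    refine ⟨x, hx, ?_⟩
    rw [collapse, hxy, norm_smul, hy, mul_one, smul_smul, Real.norm_of_nonneg hc.le,
      inv_mul_cancel₀ hc.ne', one_smul]
  set z : Fin n → ℝ := fun i => y i.succ with hz
  have hyz : y = Fin.cons (y 0) z := by
    refine funext fun i => Fin.cases rfl (fun j => rfl) i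
  have hsm : ∀ (c a : ℝ) (v : Fin n → ℝ), c • (Fin.cons a v : Fin (n + 1) → ℝ) =
      Fin.cons (c * a) (c • v) := by
    intro c a v
    refine funext fun i => Fin.cases rfl (fun j => rfl) i
  by_cases hz0 : z = 0
  · have hy0 : |y 0| = 1 := by
      rw [Fin.norm_eq_max_tail] at hy
      change max |y 0| ‖z‖ = 1 at hy
      rw [hz0, norm_zero, max_eq_left (abs_nonneg _)] at hy
      exact hy
    rcases (abs_eq zero_le_one).1 hy0 with h | h
    · refine ⟨0, by simp, 1, one_pos, ?_⟩
      rw [hyz, hz0, h, hsm]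
      simp [collapseVec]
    · have : Nonempty (Fin n) := ⟨⟨0, hn⟩⟩
      refine ⟨fun _ => 1, by simp, 1, one_pos, ?_⟩
      rw [collapseVec_of_one_le (by simp), hyz, hz0, h, hsm]
      simp
  · set k := ‖z‖ with hk
    have kpos : 0 < k := norm_pos_iff.2 hz0
    -- The equation says that (1 - 2r, (1 - r)r) is parallel to (y₀, k); its left side equals k at r
    -- = 0 and -k at r = 1.
    obtain ⟨r, ⟨hr0, hr1⟩, hr⟩ : ∃ r ∈ Icc (0 : ℝ) 1, k * (1 - 2 * r) - y 0 * ((1 - r) * r) = 0 := by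
      have := intermediate_value_Icc' (zero_le_one (α := ℝ))
        (f := fun r => k * (1 - 2 * r) - y 0 * ((1 - r) * r)) (by fun_prop)
      exact this ⟨by norm_num; exact kpos.le, by norm_num; exact kpos.le⟩
    have hr0' : 0 < r := lt_of_le_of_ne hr0 fun h => by rw [← h] at hr; norm_num at hr; linarith
    have hr1' : r < 1 := lt_of_le_of_ne hr1 fun h => by rw [h] at hr; norm_num at hr; linarith
    have hxn : ‖(r / k) • z‖ = r := by
      rw [norm_smul, Real.norm_of_nonneg (by positivity), ← hk, div_mul_cancel₀ _ kpos.ne']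
    refine ⟨(r / k) • z, hxn.le.trans hr1, (1 - r) * r / k,
      div_pos (mul_pos (by linarith) hr0') kpos, ?_⟩
    rw [hyz, hsm, collapseVec, hxn, min_eq_left hr1, smul_smul, mul_div_assoc]
    congr 1
    rw [← mul_div_assoc, div_mul_eq_mul_div, eq_div_iff kpos.ne']
    linarith

end Suspension

/-! ### Extension over balls in weakly trivial spaces -/

namespace PtdSpace

noncomputable section

variable {A : PtdSpace.{u}} {B : PtdSpace.{v}}

/-- The retraction of the space onto the unit ball. -/
def clampBall {n : ℕ} (x : Fin n → ℝ) : Fin n → ℝ := (max ‖x‖ 1)⁻¹ • x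

theorem continuous_clampBall {n : ℕ} : Continuous (clampBall : (Fin n → ℝ) → Fin n → ℝ) := by
  refine Continuous.smul ((continuous_norm.max continuous_const).inv₀ fun x => ?_) continuous_id
  exact (zero_lt_one.trans_le (le_max_right _ _)).ne'

theorem clampBall_mem {n : ℕ} (x : Fin n → ℝ) : clampBall x ∈ closedBall (0 : Fin n → ℝ) 1 := by
  rw [mem_closedBall_zero_iff, clampBall, norm_smul, Real.norm_of_nonneg (by positivity),
    inv_mul_le_iff₀ (zero_lt_one.trans_le (le_max_right _ _)), mul_one]
  exact le_max_left _ _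

theorem clampBall_of_mem {n : ℕ} {x : Fin n → ℝ} (hx : ‖x‖ ≤ 1) : clampBall x = x := by
  rw [clampBall, max_eq_right hx, inv_one, one_smul]

/-- Composing with `collapse` turns the sphere map into a map on the n-ball constant on the
boundary. Its free null-homotopy lives on a cylinder, which is a quotient presentation of the
(n+1)-ball. For n = 0 the sphere is two points, and a path joins their images. -/
theorem WeaklyTrivial.exists_extension {n : ℕ} {W : PtdSpace.{u}} (hW : W.WeaklyTrivial)
    (g : (Fin (n + 1) → ℝ) → W) (hg : ContinuousOn g (sphere 0 1)) :
    ∃ G : (Fin (n + 1) → ℝ) → W, Continuous G ∧ ∀ x, ‖x‖ = 1 → G x = g x := by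
  rcases Nat.eq_zero_or_pos n with rfl | hn
  · have hJ : Joined (g fun _ => -1) (g fun _ => 1) := (hW 0 _).trans (hW 0 _).symm
    obtain ⟨p⟩ := hJ
    refine ⟨fun x => p.extend ((x 0 + 1) / 2), by fun_prop, fun x hx => ?_⟩
    have hx0 : |x 0| = 1 := by
      rw [Fin.norm_eq_max_tail, Subsingleton.elim (fun i : Fin 0 => x i.succ) 0, norm_zero,
        max_eq_left (abs_nonneg _)] at hx
      exact hx
    have hc : ∀ c, x 0 = c → x = fun _ => c := fun c h =>
      funext fun i => by rw [Fin.fin_one_eq_zero i]; exact h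
    change p.extend ((x 0 + 1) / 2) = g x
    rcases (abs_eq zero_le_one).1 hx0 with h | h
    · rw [h, hc _ h]; norm_num
    · rw [h, hc _ h]; norm_num
  · have : Nonempty (Fin n) := ⟨⟨0, hn⟩⟩
    let e : Fin n → ℝ := fun _ => 1
    have he : 1 ≤ ‖e‖ := by simp [e]
    obtain ⟨H, hH, H0, H1, Hb⟩ := hW.exists_free_nullhomotopy n (fun x => g (collapse x))
      (hg.comp_continuous continuous_collapse fun x => by simp [norm_collapse])
      (g (collapse e)) (fun x hx => by rw [collapse_of_one_le hx he])
    -- Time 0 of the cylinder covers the sphere, time 1 is crushed to the centre.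
    let q : (Fin n → ℝ) × ℝ → Fin (n + 1) → ℝ := fun p => (1 - p.2) • collapse p.1
    have hq : Continuous q := by
      have := continuous_collapse (n := n)
      fun_prop
    have hH' : ∀ x y s t, s ∈ Icc (0 : ℝ) 1 → t ∈ Icc (0 : ℝ) 1 → q (x, s) = q (y, t) →
        H (x, s) = H (y, t) := by
      intro x y s t hs ht h
      have hst : s = t := by
        have := congrArg norm h
        simp only [q, norm_smul, norm_collapse, mul_one] at this
        rw [Real.norm_of_nonneg (by linarith [hs.2]), Real.norm_of_nonneg (by linarith [ht.2])]
          at this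
        linarith
      subst hst
      by_cases hs1 : s = 1
      · rw [hs1, H1, H1]
      · have h' : collapse x = collapse y :=
          smul_right_injective _ (sub_ne_zero.2 (Ne.symm hs1)) h
        rcases eq_or_of_collapse_eq h' with rfl | ⟨hx, hy⟩
        · rfl
        · exact Hb _ _ _ hx hy
    let T : Set ((Fin n → ℝ) × ℝ) := closedBall 0 1 ×ˢ Icc 0 1
    have hT : IsCompact T := (isCompact_closedBall _ _).prod isCompact_Icc
    have hqT : ∀ y : Fin (n + 1) → ℝ, ‖y‖ ≤ 1 → ∃ p ∈ T, q p = y := by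
      intro y hy
      by_cases hy0 : y = 0
      · exact ⟨(0, 1), by simp [T], by simp [q, hy0]⟩
      · have hyp := norm_pos_iff.2 hy0
        obtain ⟨x, hx, hxy⟩ := exists_collapse_eq hn (‖y‖⁻¹ • y) (by
          rw [norm_smul, norm_inv, norm_norm, inv_mul_cancel₀ hyp.ne'])
        refine ⟨(x, 1 - ‖y‖), ⟨by simpa using hx, by simpa using hy, by simp⟩, ?_⟩
        simp only [q, hxy, sub_sub_cancel, smul_smul]
        rw [mul_inv_cancel₀ hyp.ne', one_smul]
    choose! r hrT hr using hqT
    let Φ : (Fin (n + 1) → ℝ) → W := fun y => H (r y)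
    have hΦq : ∀ p ∈ T, Φ (q p) = H p := by
      intro p hp
      have hqn : ‖q p‖ ≤ 1 := by
        simp only [q, norm_smul, norm_collapse, mul_one]
        rw [Real.norm_of_nonneg (by linarith [hp.2.2])]
        linarith [hp.2.1]
      exact hH' _ _ _ _ (hrT _ hqn).2 hp.2 (hr _ hqn)
    have hΦ : ContinuousOn Φ (closedBall 0 1) := by
      refine (ContinuousOn.of_comp_isCompact hT hq.continuousOn
        (φ := Φ) (hH.continuousOn.congr hΦq)).mono fun y hy => ?_
      exact ⟨r y, hrT y (by simpa using hy), hr y (by simpa using hy)⟩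
    refine ⟨fun x => Φ (clampBall x), hΦ.comp_continuous continuous_clampBall clampBall_mem,
      fun x hx => ?_⟩
    change Φ (clampBall x) = g x
    rw [clampBall_of_mem hx.le]
    obtain ⟨z, hz, rfl⟩ := exists_collapse_eq hn x hx
    have := hΦq (z, 0) ⟨by simpa using hz, by simp⟩
    simp only [q, sub_zero, one_smul] at this
    rw [this, H0]

theorem WeaklyTrivial.exists_extension_subtype {n : ℕ} {W : PtdSpace.{u}} (hW : W.WeaklyTrivial)
    (g : sphere (0 : Fin (n + 1) → ℝ) 1 → W) (hg : Continuous g) :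
    ∃ G : (Fin (n + 1) → ℝ) → W, Continuous G ∧ ∀ x, G x.1 = g x := by
  classical
  let g' : (Fin (n + 1) → ℝ) → W := fun x => if h : x ∈ sphere 0 1 then g ⟨x, h⟩ else W.pt
  have hg' : ∀ x : sphere (0 : Fin (n + 1) → ℝ) 1, g' x.1 = g x := fun x => dif_pos x.2
  obtain ⟨G, hG, h⟩ := hW.exists_extension g' (by
    rw [continuousOn_iff_continuous_domRestrict]
    exact hg.congr fun x => (hg' x).symm)
  exact ⟨G, hG, fun x => (h x.1 (by simp)).trans (hg' x)⟩

end

end PtdSpace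

namespace PtdSpace

noncomputable section

variable {A : PtdSpace.{u}} {B : PtdSpace.{v}}

/-! ### The mapping path space -/

/-- The mapping path space of a map: a point of the source, with a path starting at its image. -/
def PathSp (f : Map A B) : Type (max u v) := {p : A × C(I, B) // p.2 0 = f.1 p.1}

namespace PathSp

variable {f : Map A B}

instance : TopologicalSpace (PathSp f) := inferInstanceAs (TopologicalSpace (Subtype _))

/-- The point of the source. -/
def fst (z : PathSp f) : A := z.1.1

/-- The path in the target. -/
def snd (z : PathSp f) : C(I, B) := z.1.2

/-- The end point of the path. -/
def last (z : PathSp f) : B := z.snd 1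

theorem snd_zero (z : PathSp f) : z.snd 0 = f.1 z.fst := z.2

@[fun_prop]
theorem continuous_fst : Continuous (fst : PathSp f → A) :=
  _root_.continuous_fst.comp continuous_subtype_val

@[fun_prop]
theorem continuous_snd : Continuous (snd : PathSp f → C(I, B)) :=
  _root_.continuous_snd.comp continuous_subtype_val

theorem ext {z z' : PathSp f} (h : z.fst = z'.fst) (h' : ∀ s, z.snd s = z'.snd s) : z = z' :=
  Subtype.ext (Prod.ext h (ContinuousMap.ext h'))

/-- A map to the mapping path space, from a map to the source and a homotopy. -/
def lift (f : Map A B) {T : Type*} [TopologicalSpace T] (α : T → A) (κ : C(T × I, B))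
    (h : ∀ x, κ (x, 0) = f.1 (α x)) (x : T) : PathSp f := ⟨(α x, κ.curry x), h x⟩

theorem continuous_lift {T : Type*} [TopologicalSpace T] {α : T → A}
    (hα : Continuous α) (κ : C(T × I, B)) (h : ∀ x, κ (x, 0) = f.1 (α x)) :
    Continuous (lift f α κ h) :=
  (hα.prodMk κ.curry.continuous).subtype_mk _

end PathSp

/-- On the sphere, prolonging the path of g radially through k and then to the base point gives a
map into the homotopy fibre, which extends over the ball. Backing up along the added piece restores
the prescribed end points. -/
theorem Map.IsWeq.exists_lift [PathConnectedSpace B] {f : Map A B} (hf : f.IsWeq) {n : ℕ}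
    (g : (Fin (n + 1) → ℝ) → PathSp f) (hg : ContinuousOn g (sphere 0 1))
    (k : (Fin (n + 1) → ℝ) → B) (hk : ContinuousOn k (closedBall 0 1))
    (hgk : ∀ x, ‖x‖ = 1 → (g x).last = k x) :
    ∃ G : (Fin (n + 1) → ℝ) → PathSp f, Continuous G ∧ (∀ x, ‖x‖ = 1 → G x = g x) ∧
      ∀ x, ‖x‖ ≤ 1 → (G x).last = k x := by
  wlog hkc : Continuous k generalizing k
  · obtain ⟨G, hG, h1, h2⟩ := this (fun x => k (clampBall x))
      (hk.comp_continuous continuous_clampBall clampBall_mem).continuousOn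
      (fun x hx => by rw [clampBall_of_mem hx.le]; exact hgk x hx)
      (hk.comp_continuous continuous_clampBall clampBall_mem)
    refine ⟨G, hG, h1, fun x hx => ?_⟩
    rw [h2 x hx, clampBall_of_mem hx]
  let E := Fin (n + 1) → ℝ
  obtain ⟨β⟩ := PathConnectedSpace.joined (k 0) B.pt
  let K₂ : E × ℝ → B := fun p => if p.2 ≤ 2 then k ((2 - p.2) • p.1) else β.extend (p.2 - 2)
  have hK₂ : Continuous K₂ := by
    refine Continuous.if_le (by fun_prop) (by fun_prop) (by fun_prop) (by fun_prop) ?_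
    intro p hp
    simp [hp]
  -- Three unit time intervals: the path of g(x), then k along the radius from x to the centre, then
  -- β to the base point.
  let K : E × ℝ → B := fun p => if p.2 ≤ 1 then (g p.1).snd (projIcc 0 1 zero_le_one p.2)
    else K₂ p
  have hK : ContinuousOn K (sphere 0 1 ×ˢ univ) := by
    rw [continuousOn_iff_continuous_domRestrict]
    have hg' : Continuous fun p : ↥((sphere (0 : E) 1) ×ˢ (univ : Set ℝ)) => g p.1.1 :=
      hg.comp_continuous (by fun_prop) fun p => p.2.1
    have hg'' : Continuous fun p : ↥((sphere (0 : E) 1) ×ˢ (univ : Set ℝ)) => (g p.1.1).snd :=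
      PathSp.continuous_snd.comp hg'
    refine Continuous.if_le (by fun_prop) (hK₂.comp (by fun_prop)) (by fun_prop) (by fun_prop) ?_
    rintro ⟨⟨x, s⟩, hxs⟩ hs
    obtain rfl : s = 1 := hs
    have hx' : ‖x‖ = 1 := by simpa using hxs.1
    simp only [projIcc_right]
    refine (hgk x hx').trans ?_
    norm_num [K₂]
  have hK1 : ∀ (x : E) (s : ℝ), ‖x‖ = 1 → 1 ≤ s → K (x, s) = K₂ (x, s) := by
    intro x s hx hs
    simp only [K]
    split_ifs with h
    · obtain rfl : s = 1 := le_antisymm h hs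
      rw [projIcc_right]
      refine (hgk x hx).trans ?_
      norm_num [K₂]
    · rfl
  have hK0 : ∀ (x : E) (s : I), K (x, s) = (g x).snd s := by
    intro x s
    simp only [K, if_pos s.2.2, projIcc_val]
  obtain ⟨G₁, hG₁, hG₁S⟩ := hf.hfib.exists_extension_subtype (n := n)
    (fun x : sphere (0 : E) 1 => hfib.mk f (g x.1).fst
      ⟨fun s => K (x.1, 3 * s), hK.comp_continuous (by fun_prop) fun s => ⟨x.2, trivial⟩⟩
      (by
        simp only [ContinuousMap.coe_mk]
        have := hK0 x.1 0
        simp only [Icc.coe_zero] at this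
        rw [Icc.coe_zero, mul_zero, this, PathSp.snd_zero])
      (by
        simp only [ContinuousMap.coe_mk]
        rw [Icc.coe_one, mul_one, hK1 _ _ (by simp) (by norm_num)]
        norm_num [K₂]))
    (by
      refine hfib.continuous_mk _ _ ?_ ?_
      · exact PathSp.continuous_fst.comp (hg.comp_continuous (by fun_prop) fun x => x.2)
      · exact hK.comp_continuous (by fun_prop : Continuous fun p : sphere (0 : E) 1 × I =>
          (p.1.1, 3 * (p.2 : ℝ))) fun p => ⟨p.1.2, trivial⟩)
  have hG₁f : ∀ x : E, ‖x‖ = 1 → hfib.fst (G₁ x) = (g x).fst := fun x hx =>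
    congrArg hfib.fst (hG₁S ⟨x, by simpa using hx⟩)
  have hG₁s : ∀ (x : E) (s : I), ‖x‖ = 1 → hfib.snd (G₁ x) s = K (x, 3 * s) := fun x s hx =>
    congrArg (fun z => hfib.snd z s) (hG₁S ⟨x, by simpa using hx⟩)
  let nrm : E → E := fun x => ‖x‖⁻¹ • x
  have hnrm : ContinuousOn nrm {x | 1 / 2 ≤ ‖x‖} := by
    refine ContinuousOn.smul (continuous_norm.continuousOn.inv₀ fun x hx => ?_) continuousOn_id
    exact (lt_of_lt_of_le (by norm_num) hx).ne'
  have hnrm1 : ∀ x : E, 1 / 2 ≤ ‖x‖ → ‖nrm x‖ = 1 := by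
    intro x hx
    have : 0 < ‖x‖ := lt_of_lt_of_le (by norm_num) hx
    rw [norm_smul, norm_inv, norm_norm, inv_mul_cancel₀ this.ne']
  have hnrm2 : ∀ x : E, ‖x‖ = 1 / 2 → nrm x = (2 : ℝ) • x := by
    intro x hx
    simp only [nrm, hx]
    norm_num
  let α : E → A := fun x => if ‖x‖ ≤ 1 / 2 then hfib.fst (G₁ ((2 : ℝ) • x)) else (g (nrm x)).fst
  have hα : Continuous α := by
    refine continuous_if_le (by fun_prop) (by fun_prop) ?_ ?_ ?_
    · exact (hfib.continuous_fst.comp (hG₁.comp (by fun_prop))).continuousOn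
    · refine PathSp.continuous_fst.comp_continuousOn (hg.comp hnrm fun x hx => ?_)
      simpa using hnrm1 x hx
    · intro x hx
      rw [hnrm2 x hx, hG₁f]
      rw [norm_smul, hx]; norm_num
  -- In the annulus 1/2 ≤ r ≤ 1 the path follows K out to time 5 - 4r and returns to time 2 - r,
  -- where K is k(x). At r = 1 this is ζ = s, the original path; at r = 1/2 it goes out to time 3,
  -- reached at s = 2/3, and matches `κi`.
  let ζ : ℝ → ℝ → ℝ := fun r s => min ((8 - 7 * r) * s) (2 * (5 - 4 * r) - (8 - 7 * r) * s)
  let κi : E × I → B := fun p =>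
    if (p.2 : ℝ) ≤ 2 / 3 then hfib.snd (G₁ ((2 : ℝ) • p.1)) (projIcc 0 1 zero_le_one (3 / 2 * p.2))
    else K₂ ((2 : ℝ) • p.1, 6 - 9 / 2 * p.2)
  have hκi : Continuous κi := by
    refine Continuous.if_le ?_ (hK₂.comp (by fun_prop)) (by fun_prop) (by fun_prop) ?_
    · have : Continuous fun p : E × I => hfib.snd (G₁ ((2 : ℝ) • p.1)) :=
        hfib.continuous_snd.comp (hG₁.comp (by fun_prop))
      fun_prop
    · rintro ⟨x, s⟩ hs
      replace hs : (s : ℝ) = 2 / 3 := hs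
      simp only [hs]
      norm_num
      rw [hfib.snd_one]
      norm_num [K₂]
  let κo : E × I → B := fun p => K (nrm p.1, ζ (min ‖p.1‖ 1) p.2)
  have hκo : ContinuousOn κo {p | 1 / 2 ≤ ‖p.1‖} := by
    refine hK.comp (ContinuousOn.prodMk ?_ ?_) fun p hp => ⟨by simpa using hnrm1 p.1 hp, trivial⟩
    · exact hnrm.comp continuous_fst.continuousOn fun p hp => hp
    · exact Continuous.continuousOn (by fun_prop)
  have hio : ∀ p : E × I, ‖p.1‖ = 1 / 2 → κi p = κo p := by
    rintro ⟨x, s⟩ hx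
    replace hx : ‖x‖ = 1 / 2 := hx
    have h2x : ‖(2 : ℝ) • x‖ = 1 := by rw [norm_smul, hx]; norm_num
    simp only [κi, κo, hnrm2 x hx, hx, ζ]
    rw [min_eq_left (by norm_num : (1 / 2 : ℝ) ≤ 1)]
    split_ifs with hs
    · rw [hG₁s _ _ h2x, min_eq_left (by linarith), coe_projIcc, min_eq_right (by linarith),
        max_eq_right (by linarith [s.2.1])]
      congr 2
      ring
    · rw [min_eq_right (by linarith), hK1 _ _ h2x (by linarith [s.2.2])]
      congr 2
      ring
  let κ : C(E × I, B) := ⟨fun p => if ‖p.1‖ ≤ 1 / 2 then κi p else κo p,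
    continuous_if_le (by fun_prop) (by fun_prop) hκi.continuousOn hκo hio⟩
  have hκ : ∀ p, κ p = if ‖p.1‖ ≤ 1 / 2 then κi p else κo p := fun p => rfl
  have h0 : ∀ x, κ (x, 0) = f.1 (α x) := by
    intro x
    rw [hκ]
    simp only [α]
    split_ifs with hx
    · simp only [κi]
      norm_num
      exact hfib.snd_zero _
    · have hm : min ‖x‖ 1 ≤ 1 := min_le_right _ _
      simp only [κo, ζ, Icc.coe_zero, mul_zero]
      rw [min_eq_left (by linarith), ← PathSp.snd_zero]
      simpa using hK0 (nrm x) 0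
  refine ⟨PathSp.lift f α κ h0, PathSp.continuous_lift hα κ h0, fun x hx => ?_, fun x hx => ?_⟩
  · have hn : nrm x = x := by simp [nrm, hx]
    have hx2 : ¬ ‖x‖ ≤ 1 / 2 := by rw [hx]; norm_num
    refine PathSp.ext ?_ fun s => ?_
    · change α x = _
      simp only [α, if_neg hx2, hn]
    · change κ (x, s) = _
      rw [hκ, if_neg hx2]
      simp only [κo, ζ, hn, hx]
      rw [min_self, min_eq_left (by linarith [s.2.2]), ← hK0]
      congr 2
      ring
  · change κ (x, 1) = k x
    rw [hκ]
    split_ifs with hx2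
    · simp only [κi, Icc.coe_one]
      rw [if_neg (by norm_num)]
      norm_num [K₂, smul_smul]
    · have hxp : 0 < ‖x‖ := by linarith
      simp only [κo, ζ, Icc.coe_one, min_eq_left hx]
      rw [min_eq_right (by linarith), hK1 _ _ (hnrm1 x (by linarith)) (by linarith)]
      simp only [K₂, nrm]
      rw [if_pos (by linarith), smul_smul]
      congr 1
      rw [show (2 - (2 * (5 - 4 * ‖x‖) - (8 - 7 * ‖x‖) * 1)) = ‖x‖ by ring,
        mul_inv_cancel₀ hxp.ne', one_smul]

end

end PtdSpace

/-! ### Lifting along cell complexes -/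

namespace Topology.CWComplex

open Topology RelCWComplex

variable {K : Type u} [TopologicalSpace K] [CWComplex (univ : Set K)]

theorem eq_of_mem_openCell {x : K} {n m : ℕ} {i : cell (univ : Set K) n}
    {j : cell (univ : Set K) m} (hi : x ∈ openCell n i) (hj : x ∈ openCell m j) :
    (⟨n, i⟩ : Σ n, cell (univ : Set K) n) = ⟨m, j⟩ :=
  eq_of_not_disjoint_openCell (not_disjoint_iff.2 ⟨x, hi, hj⟩)

theorem exists_mem_openCell (x : K) : ∃ (n : ℕ) (i : cell (univ : Set K) n), x ∈ openCell n i := by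
  have := (iUnion_openCell_eq_complex (C := (univ : Set K))).symm.subset (mem_univ x)
  simpa using this

theorem exists_mem_openCell_of_mem_cellFrontier {x : K} {n : ℕ} {i : cell (univ : Set K) n}
    (hx : x ∈ cellFrontier n i) : ∃ m < n, ∃ j : cell (univ : Set K) m, x ∈ openCell m j := by
  obtain ⟨J, hJ⟩ := cellFrontier_subset_finite_openCell n i
  have := hJ hx
  simp only [mem_iUnion, exists_prop] at this
  obtain ⟨m, hm, j, -, hj⟩ := this
  exact ⟨m, hm, j, hj⟩

theorem le_of_mem_closedCell {x : K} {n m : ℕ} {i : cell (univ : Set K) n}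
    {j : cell (univ : Set K) m} (hi : x ∈ openCell n i) (hj : x ∈ closedCell m j) : n ≤ m := by
  rw [← cellFrontier_union_openCell_eq_closedCell] at hj
  rcases hj with hj | hj
  · obtain ⟨d, hd, l, hl⟩ := exists_mem_openCell_of_mem_cellFrontier hj
    rw [(Sigma.mk.inj_iff.1 (eq_of_mem_openCell hi hl)).1]
    exact hd.le
  · exact (Sigma.mk.inj_iff.1 (eq_of_mem_openCell hi hj)).1.le

variable [T2Space K]

theorem continuous_of_continuousOn_closedCell {E : Type*} [TopologicalSpace E] {g : K → E}
    (h : ∀ n (i : cell (univ : Set K) n), ContinuousOn g (closedCell n i)) : Continuous g := by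
  refine continuous_iff_isClosed.2 fun C hC => ?_
  refine (CWComplex.closed (univ : Set K) _ (subset_univ _)).2 fun n j => ?_
  rw [inter_comm]
  exact (h n j).preimage_isClosed_of_isClosed isClosed_closedCell hC

theorem continuousOn_cellFrontier {E : Type*} [TopologicalSpace E] {g : K → E} {n : ℕ}
    (h : ∀ m < n, ∀ i : cell (univ : Set K) m, ContinuousOn g (closedCell m i))
    (i : cell (univ : Set K) n) : ContinuousOn g (cellFrontier n i) := by
  obtain ⟨J, hJ⟩ := cellFrontier_subset_finite_closedCell n i
  have hc : ContinuousOn g (⋃ q : Σ m : Fin n, J m, closedCell q.1.1 q.2.1) :=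
    (locallyFinite_of_finite _).continuousOn_iUnion (fun q => isClosed_closedCell)
      fun q => h q.1 q.1.2 q.2
  refine hc.mono (hJ.trans fun x hx => ?_)
  simp only [mem_iUnion, exists_prop] at hx ⊢
  obtain ⟨m, hm, j, hj, hx⟩ := hx
  exact ⟨⟨⟨m, hm⟩, ⟨j, hj⟩⟩, hx⟩

variable {E : Type v} {B : Type w} [TopologicalSpace E] [TopologicalSpace B]

/-- The lifting property of a map with respect to the boundary inclusions of cubes of positive
dimension. -/
def HasCubeLifting (p : E → B) : Prop :=
  ∀ (n : ℕ) (g : (Fin (n + 1) → ℝ) → E), ContinuousOn g (sphere 0 1) →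
    ∀ k : (Fin (n + 1) → ℝ) → B, ContinuousOn k (closedBall 0 1) →
      (∀ x, ‖x‖ = 1 → p (g x) = k x) →
      ∃ G : (Fin (n + 1) → ℝ) → E, Continuous G ∧ (∀ x, ‖x‖ = 1 → G x = g x) ∧
        ∀ x, ‖x‖ ≤ 1 → p (G x) = k x

/-- The lift is kept as a possibly discontinuous function on all of K, and each step only improves
it on the cells of one further dimension, so skeleta never appear as spaces. -/
theorem HasCubeLifting.exists_extend_cells {p : E → B} (hp : HasCubeLifting p) {h : K → B}
    (hh : Continuous h) {n : ℕ} {g : K → E} (hgp : ∀ x, p (g x) = h x)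
    (hg : ∀ m < n + 1, ∀ i : cell (univ : Set K) m, ContinuousOn g (closedCell m i)) :
    ∃ g' : K → E, (∀ x, p (g' x) = h x) ∧
      (∀ m < n + 2, ∀ i : cell (univ : Set K) m, ContinuousOn g' (closedCell m i)) ∧
      ∀ x m (i : cell (univ : Set K) m), x ∈ openCell m i → m < n + 1 → g' x = g x := by
  classical
  have hl : ∀ i : cell (univ : Set K) (n + 1), ∃ G : (Fin (n + 1) → ℝ) → E, Continuous G ∧
      (∀ x, ‖x‖ = 1 → G x = g (map (n + 1) i x)) ∧
      ∀ x, ‖x‖ ≤ 1 → p (G x) = h (map (n + 1) i x) := by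
    intro i
    refine hp n (fun x => g (map (n + 1) i x)) ?_ (fun x => h (map (n + 1) i x)) ?_
      fun x _ => hgp _
    · refine (continuousOn_cellFrontier hg i).comp
        ((continuousOn (n + 1) i).mono sphere_subset_closedBall) fun x hx => ⟨x, hx, rfl⟩
    · exact hh.comp_continuousOn (continuousOn (n + 1) i)
  choose G hG hGs hGp using hl
  let g' : K → E := fun x =>
    if hx : ∃ i : cell (univ : Set K) (n + 1), x ∈ openCell (n + 1) i then
      G hx.choose ((map (n + 1) hx.choose).symm x) else g x
  have hopen : ∀ (i : cell (univ : Set K) (n + 1)) (x : Fin (n + 1) → ℝ), ‖x‖ < 1 →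
      g' (map (n + 1) i x) = G i x := by
    intro i x hx
    have hxb : x ∈ ball (0 : Fin (n + 1) → ℝ) 1 := by simpa using hx
    have hx' : ∃ j : cell (univ : Set K) (n + 1), map (n + 1) i x ∈ openCell (n + 1) j :=
      ⟨i, x, hxb, rfl⟩
    have e : hx'.choose = i := by
      have := eq_of_mem_openCell hx'.choose_spec (⟨x, hxb, rfl⟩ : map (n + 1) i x ∈ openCell _ i)
      simpa using this
    simp only [g', dif_pos hx']
    rw [e, (map (n + 1) i).left_inv (by rw [source_eq]; exact hxb)]
  have hlow : ∀ x m (i : cell (univ : Set K) m), x ∈ openCell m i → m < n + 1 → g' x = g x := by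
    intro x m i hx hm
    have hx' : ¬ ∃ j : cell (univ : Set K) (n + 1), x ∈ openCell (n + 1) j := by
      rintro ⟨j, hj⟩
      exact hm.ne (Sigma.mk.inj_iff.1 (eq_of_mem_openCell hx hj)).1
    simp only [g', dif_neg hx']
  have hball : ∀ (i : cell (univ : Set K) (n + 1)) (x : Fin (n + 1) → ℝ), ‖x‖ ≤ 1 →
      g' (map (n + 1) i x) = G i x := by
    intro i x hx
    rcases hx.lt_or_eq with hx | hx
    · exact hopen i x hx
    · obtain ⟨m, hm, j, hj⟩ := exists_mem_openCell_of_mem_cellFrontier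
        (⟨x, by simpa using hx, rfl⟩ : map (n + 1) i x ∈ cellFrontier _ i)
      rw [hlow _ m j hj hm, hGs i x hx]
  refine ⟨g', fun x => ?_, fun m hm i => ?_, hlow⟩
  · by_cases hx : ∃ i : cell (univ : Set K) (n + 1), x ∈ openCell (n + 1) i
    · obtain ⟨i, y, hy, rfl⟩ := hx
      have hy' : ‖y‖ < 1 := by simpa using hy
      rw [hopen i y hy', hGp i y hy'.le]
    · simp only [g', dif_neg hx, hgp]
  · rcases Nat.lt_succ_iff_lt_or_eq.1 hm with hm | rfl
    · refine (hg m hm i).congr fun x hx => ?_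
      obtain ⟨d, j, hj⟩ := exists_mem_openCell x
      exact hlow x d j hj ((le_of_mem_closedCell hj hx).trans_lt hm)
    · refine ContinuousOn.of_comp_isCompact (isCompact_closedBall _ _) (continuousOn (n + 1) i) ?_
      exact (hG i).continuousOn.congr fun x hx => hball i x (by simpa using hx)

theorem HasCubeLifting.exists_lift {p : E → B} (hp : HasCubeLifting p)
    (hs : Function.Surjective p) {h : K → B} (hh : Continuous h) {x₀ : K}
    (hx₀ : ∃ i : cell (univ : Set K) 0, x₀ ∈ openCell 0 i) {e₀ : E} (he₀ : p e₀ = h x₀) :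
    ∃ g : K → E, Continuous g ∧ g x₀ = e₀ ∧ ∀ x, p (g x) = h x := by
  classical
  let Good (n : ℕ) (g : K → E) : Prop := (∀ x, p (g x) = h x) ∧
    ∀ m < n + 1, ∀ i : cell (univ : Set K) m, ContinuousOn g (closedCell m i)
  have step : ∀ (n : ℕ) (g : {g : K → E // Good n g}), ∃ g' : {g : K → E // Good (n + 1) g},
      ∀ x m (i : cell (univ : Set K) m), x ∈ openCell m i → m < n + 1 → g'.1 x = g.1 x := by
    rintro n ⟨g, hg⟩
    obtain ⟨g', h1, h2, h3⟩ := hp.exists_extend_cells hh hg.1 hg.2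
    exact ⟨⟨g', h1, h2⟩, h3⟩
  choose next hnext using step
  choose r hr using hs
  -- On 0-cells continuity is free, so surjectivity of p suffices there; the value at the base point
  -- can be prescribed since it is a vertex.
  let g₀ : K → E := fun x => if x = x₀ then e₀ else r (h x)
  have hg₀ : Good 0 g₀ := by
    refine ⟨fun x => ?_, fun m hm i => ?_⟩
    · simp only [g₀]
      split_ifs with hx
      · rw [he₀, hx]
      · exact hr _
    · obtain rfl : m = 0 := by omega
      rw [closedCell_zero_eq_singleton]
      exact continuousOn_singleton _ _
  let s : ∀ n, {g : K → E // Good n g} := fun n => Nat.rec ⟨g₀, hg₀⟩ (fun n g => next n g) n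
  have hss : ∀ n x m (i : cell (univ : Set K) m), x ∈ openCell m i → m < n + 1 →
      (s (n + 1)).1 x = (s n).1 x := fun n x m i hx hm => hnext n (s n) x m i hx hm
  have hstab : ∀ x m (i : cell (univ : Set K) m), x ∈ openCell m i → ∀ n, m ≤ n →
      (s n).1 x = (s m).1 x := by
    intro x m i hx n hn
    induction n, hn using Nat.le_induction with
    | base => rfl
    | succ n hmn ih => rw [hss n x m i hx (by omega), ih]
  choose d c hc using exists_mem_openCell (K := K)
  -- The value at x is fixed from the stage equal to the dimension of the open cell containing x.
  refine ⟨fun x => (s (d x)).1 x, ?_, ?_, fun x => (s (d x)).2.1 x⟩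
  · refine continuous_of_continuousOn_closedCell fun n i => ?_
    refine ((s n).2.2 n (Nat.lt_succ_self n) i).congr fun x hx => ?_
    exact (hstab x _ (c x) (hc x) n (le_of_mem_closedCell (hc x) hx)).symm
  · obtain ⟨i, hi⟩ := hx₀
    have hd : d x₀ = 0 := (Sigma.mk.inj_iff.1 (eq_of_mem_openCell (hc x₀) hi)).1
    change (s (d x₀)).1 x₀ = e₀
    rw [hd]
    exact if_pos rfl

/-- A union of path components contains or misses each closed cell, so it is closed in the weak
topology; the same holds for its complement. -/
theorem pathConnectedSpace [ConnectedSpace K] : PathConnectedSpace K := by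
  have hcell : ∀ (n : ℕ) (i : cell (univ : Set K) n) x y, x ∈ closedCell n i →
      y ∈ closedCell n i → Joined x y := by
    intro n i x y hx hy
    have : IsPathConnected (closedCell n i) :=
      ((convex_closedBall (0 : Fin n → ℝ) 1).isPathConnected
        ⟨0, by simp⟩).image' (continuousOn n i)
    exact (this.joinedIn x hx y hy).joined
  have hclosed : ∀ S : Set K, (∀ x y, x ∈ S → Joined x y → y ∈ S) → IsClosed S := by
    intro S hS
    refine (CWComplex.closed (univ : Set K) S (subset_univ _)).2 fun n j => ?_
    rcases (S ∩ closedCell n j).eq_empty_or_nonempty with h | ⟨x, hx⟩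
    · rw [h]; exact isClosed_empty
    · rw [inter_eq_right.2 fun y hy => hS x y hx.1 (hcell n j x y hx.2 hy)]
      exact isClosed_closedCell
  obtain ⟨x₀⟩ := (inferInstance : Nonempty K)
  have hclopen : IsClopen {x : K | Joined x₀ x} := by
    refine ⟨hclosed _ fun x y hx hxy => hx.trans hxy, ?_⟩
    rw [← isClosed_compl_iff]
    exact hclosed _ fun x y hx hxy hy => hx (hy.trans hxy.symm)
  have huniv := hclopen.eq_univ ⟨x₀, Joined.refl x₀⟩
  have hj : ∀ x, Joined x₀ x := fun x => huniv.symm.subset (mem_univ x)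
  exact ⟨⟨x₀⟩, fun x y => (hj x).symm.trans (hj y)⟩

end Topology.CWComplex

namespace PtdSpace

/-! ### Whitehead's theorem -/

variable {A : PtdSpace.{u}} {B : PtdSpace.{v}} {X : PtdSpace.{w}}

theorem Map.IsWeq.hasCubeLifting [PathConnectedSpace B] {f : Map A B} (hf : f.IsWeq) :
    Topology.CWComplex.HasCubeLifting (PathSp.last : PathSp f → B) :=
  fun _ g hg k hk h => hf.exists_lift g hg k hk h

theorem PathSp.last_surjective [PathConnectedSpace B] (f : Map A B) :
    Function.Surjective (PathSp.last : PathSp f → B) := by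
  intro b
  obtain ⟨p⟩ := PathConnectedSpace.joined (f.1 A.pt) b
  exact ⟨⟨(A.pt, p.toContinuousMap), p.source⟩, p.target⟩

theorem HEquiv.pathConnectedSpace (h : HEquiv A B) [PathConnectedSpace B] :
    PathConnectedSpace A := by
  obtain ⟨f, g, hgf, -⟩ := h
  obtain ⟨F, hF, h0, h1, -⟩ := Map.homotopic_iff.1 hgf
  have hj : ∀ x, Joined A.pt x := by
    intro x
    have h₁ : Joined (g.1 (f.1 x)) x :=
      ⟨⟨⟨fun s => F (s, x), by fun_prop⟩, h0 x, h1 x⟩⟩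
    have h₂ : Joined (g.1 B.pt) (g.1 (f.1 x)) :=
      (PathConnectedSpace.joined B.pt (f.1 x)).map g.1.continuous
    rw [g.2] at h₂
    exact h₂.trans h₁
  exact ⟨⟨A.pt⟩, fun x y => (hj x).symm.trans (hj y)⟩

theorem HasConnectedCWType.pathConnectedSpace (h : HasConnectedCWType X) :
    PathConnectedSpace X := by
  obtain ⟨K, _, _, _, -, hK⟩ := h
  have := Topology.CWComplex.pathConnectedSpace (K := K)
  exact hK.pathConnectedSpace

/-- A map into the mapping path space lifting h is a map g together with a homotopy from f ∘ g to h.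
Only the source X needs a CW type. -/
theorem HasConnectedCWType.exists_lift (hX : HasConnectedCWType X) [PathConnectedSpace A]
    [PathConnectedSpace B] (f : Map A B) (hf : Function.Bijective f.pis) (h : Map X B) :
    ∃ g : Map X A, (f.comp g).Homotopic h := by
  obtain ⟨K, _, _, _, hpt, a, b, hba, -⟩ := hX
  have hf' := f.isWeq_of_bijective hf
  obtain ⟨G, hG, hG0, hGp⟩ := hf'.hasCubeLifting.exists_lift (PathSp.last_surjective f)
    (h.comp b).1.continuous hpt
    (e₀ := ⟨(A.pt, ContinuousMap.const I B.pt), f.2.symm⟩) (h.comp b).2.symm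
  let g : Map K A := ⟨⟨fun x => (G x).fst, PathSp.continuous_fst.comp hG⟩, congrArg PathSp.fst hG0⟩
  have hg : (f.comp g).Homotopic (h.comp b) := by
    refine Map.homotopic_iff.2 ⟨fun p => (G p.2).snd p.1, ?_, fun x => PathSp.snd_zero _, hGp,
      fun s => congrArg (fun z : PathSp f => z.snd s) hG0⟩
    have := PathSp.continuous_snd.comp hG
    exact (this.comp continuous_snd).eval continuous_fst
  exact ⟨g.comp a, (hg.comp (Map.Homotopic.refl a)).trans ((Map.Homotopic.refl h).comp hba)⟩

/-- Whitehead's theorem: a map inducing an isomorphism of homotopy groups is an equivalence. -/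
theorem Map.exists_inverse (hA : A.HasConnectedCWType) (hB : B.HasConnectedCWType) (f : Map A B)
    (hf : Function.Bijective f.pis) :
    ∃ g : Map B A, (g.comp f).Homotopic (Map.id A) ∧ (f.comp g).Homotopic (Map.id B) := by
  have := hA.pathConnectedSpace
  have := hB.pathConnectedSpace
  obtain ⟨g, hg⟩ := hB.exists_lift f hf (Map.id B)
  have hfg : Function.LeftInverse f.pis g.pis := by
    intro x
    have := hg.pis
    rw [Map.pis_comp, Map.pis_id] at this
    exact DFunLike.congr_fun this x
  have hgb : Function.Bijective g.pis :=
    ⟨hfg.injective, fun a => ⟨f.pis a, hf.1 (hfg _)⟩⟩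
  -- The right inverse g has a right inverse k of its own, and f ≃ f g k ≃ k makes g two-sided.
  obtain ⟨k, hk⟩ := hA.exists_lift g hgb (Map.id A)
  have hfk : f.Homotopic k :=
    ((Map.Homotopic.refl f).comp hk).symm.trans (hg.comp (Map.Homotopic.refl k))
  exact ⟨g, ((Map.Homotopic.refl g).comp hfk).trans hk, hg⟩

end PtdSpace

end CellularLifting

namespace PtdSpace

open scoped unitInterval

noncomputable section

variable {X : PtdSpace.{u}} {Y : PtdSpace.{v}} {Z : PtdSpace.{w}}

/-! ### Products -/

section Pi

variable {ι : Type t} {F : ι → PtdSpace.{v}}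

/-- The projections from a product. -/
def proj (F : ι → PtdSpace.{v}) (i : ι) : Map (pi F) (F i) :=
  ⟨⟨fun x : ∀ i, F i => x i, continuous_apply i⟩, rfl⟩

/-- The map to a product with given components. -/
def Map.toPi (f : ∀ i, Map X (F i)) : Map X (pi F) :=
  ⟨⟨fun x => (fun i => (f i).1 x : ∀ i, F i), continuous_pi fun i => (f i).1.continuous⟩,
    funext fun i => (f i).2⟩

theorem proj_comp_toPi (f : ∀ i, Map X (F i)) (i : ι) : (proj F i).comp (Map.toPi f) = f i := rfl

theorem Map.homotopic_pi {f g : Map X (pi F)}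
    (h : ∀ i, ((proj F i).comp f).Homotopic ((proj F i).comp g)) : f.Homotopic g := by
  choose G hG h0 h1 hp using fun i => Map.homotopic_iff.1 (h i)
  exact Map.homotopic_iff.2 ⟨fun p => (fun i => G i p : ∀ i, F i), continuous_pi hG,
    fun x => funext fun i => h0 i x, fun x => funext fun i => h1 i x, fun s => funext fun i => hp i s⟩

/-- The product of H-structures. -/
def HStructure.pi (H : ∀ i, HStructure (F i)) : HStructure (PtdSpace.pi F) :=
  HStructure.mk' (X := PtdSpace.pi F)
    ⟨fun p => (fun i => (H i).toHSpace.hmul ((proj F i).1 p.1, (proj F i).1 p.2) : ∀ i, F i),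
      continuous_pi fun i => by fun_prop⟩
    (funext fun i => (H i).hmul_pt)
    (Map.homotopic_pi fun i => (H i).zero_add_homotopic (proj F i))
    (Map.homotopic_pi fun i => (H i).add_zero_homotopic (proj F i))

theorem proj_comp_add (H : ∀ i, HStructure (F i)) (f g : Map X (pi F)) (i : ι) :
    (proj F i).comp (Map.add (HStructure.pi H) f g) =
      Map.add (H i) ((proj F i).comp f) ((proj F i).comp g) := rfl

instance [h : ∀ i, IsH (F i)] : IsH (pi F) :=
  ⟨⟨HStructure.pi fun i => (h i).nonempty.some⟩⟩

/-- The coordinates in a set, the other ones being replaced by the base point. -/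
def coords (F : ι → PtdSpace.{v}) [DecidableEq ι] (s : Finset ι) : Map (pi F) (pi F) :=
  Map.toPi fun i => if i ∈ s then proj F i else Map.zero _ _

/-- The inclusions into a product. -/
def incl (F : ι → PtdSpace.{v}) [DecidableEq ι] (i : ι) : Map (F i) (pi F) :=
  Map.toPi fun j => if h : i = j then h ▸ Map.id (F i) else Map.zero _ _

theorem proj_comp_incl_self [DecidableEq ι] (i : ι) :
    (proj F i).comp (incl F i) = Map.id (F i) := by
  rw [incl, proj_comp_toPi, dif_pos rfl]

theorem proj_comp_incl_of_ne [DecidableEq ι] {i j : ι} (h : i ≠ j) :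
    (proj F j).comp (incl F i) = Map.zero (F i) (F j) := by
  rw [incl, proj_comp_toPi, dif_neg h]

/-- The identity of the product is built by adding one coordinate at a time; each addition has a
constant summand in every coordinate, so the homotopy unit suffices. -/
theorem sum_incl_proj [Fintype ι] [DecidableEq ι] [∀ i, IsH (F i)] (x : (pi F).Pis) :
    ∑ i, (incl F i).pis ((proj F i).pis x) = x := by
  have H : ∀ i, HStructure (F i) := fun i => (IsH.nonempty (X := F i)).some
  have key : ∀ s : Finset ι, ∑ i ∈ s, (incl F i).pis ((proj F i).pis x) = (coords F s).pis x := by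
    intro s
    induction s using Finset.induction_on with
    | empty =>
      have : coords F ∅ = Map.zero _ _ := by
        simp only [coords, Finset.notMem_empty, if_false]
        rfl
      rw [this, Map.pis_zero, Finset.sum_empty, AddMonoidHom.zero_apply]
    | insert a s ha ih =>
      have hh : (Map.add (HStructure.pi H) ((incl F a).comp (proj F a)) (coords F s)).Homotopic
          (coords F (insert a s)) := by
        refine Map.homotopic_pi fun i => ?_
        have e : (proj F i).comp ((incl F a).comp (proj F a)) =
            ((proj F i).comp (incl F a)).comp (proj F a) := rfl
        rw [proj_comp_add, e]
        simp only [coords, proj_comp_toPi]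
        by_cases hai : a = i
        · subst hai
          rw [proj_comp_incl_self, if_neg ha, if_pos (Finset.mem_insert_self a s)]
          exact (H a).add_zero_homotopic (proj F a)
        · rw [proj_comp_incl_of_ne hai]
          simp only [Finset.mem_insert, show i ≠ a from fun h => hai h.symm, false_or]
          exact (H i).zero_add_homotopic _
      rw [Finset.sum_insert ha, ih, ← hh.pis, Map.pis_add, Map.pis_comp]
      rfl
  rw [key]
  have : coords F Finset.univ = Map.id _ := by
    simp only [coords, Finset.mem_univ, if_true]
    rfl
  rw [this, Map.pis_id, AddMonoidHom.id_apply]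

end Pi

/-! ### Negatives -/

/-- The property of being an H-space with the homotopy type of a connected CW complex. -/
class IsCWH (X : PtdSpace.{u}) : Prop extends IsH X where
  cw : X.HasConnectedCWType

/-- The shear map (x, y) ↦ (x, x + y) is bijective on homotopy groups. Lifting (id, 0) through it
gives (id, ν) up to homotopy. The lifting is along X, so no CW type is required of X × X. -/
theorem exists_pis_eq_neg (X : PtdSpace.{u}) [hX : IsCWH X] :
    ∃ ν : Map X X, ∀ x, ν.pis x = -x := by
  have hXp := hX.cw.pathConnectedSpace
  obtain ⟨H⟩ := IsH.nonempty (X := X)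
  let F : Bool → PtdSpace.{u} := fun _ => X
  have : PathConnectedSpace (pi F) := inferInstanceAs (PathConnectedSpace (Bool → X))
  let s : Map (pi F) (pi F) := Map.toPi fun b => bif b then
    Map.add H (proj F false) (proj F true) else proj F false
  have hs0 : ∀ x, (proj F false).pis (s.pis x) = (proj F false).pis x := fun x => by
    rw [← AddMonoidHom.comp_apply, ← Map.pis_comp, proj_comp_toPi]
    rfl
  have hs1 : ∀ x, (proj F true).pis (s.pis x) =
      (proj F false).pis x + (proj F true).pis x := fun x => by
    rw [← AddMonoidHom.comp_apply, ← Map.pis_comp, proj_comp_toPi]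
    exact DFunLike.congr_fun (Map.pis_add H (proj F false) (proj F true)) x
  have hsum : ∀ x : (pi F).Pis, (incl F true).pis ((proj F true).pis x) +
      (incl F false).pis ((proj F false).pis x) = x := fun x => by
    have := sum_incl_proj x
    rwa [Fintype.sum_bool] at this
  have hself : ∀ (b : Bool) (y : X.Pis), (proj F b).pis ((incl F b).pis y) = y := fun b y => by
    have := DFunLike.congr_fun (Map.pis_comp (proj F b) (incl F b)) y
    rw [proj_comp_incl_self, Map.pis_id] at this
    exact this.symm
  have hne : ∀ (b c : Bool) (y : X.Pis), b ≠ c → (proj F c).pis ((incl F b).pis y) = 0 :=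
    fun b c y h => by
    have := DFunLike.congr_fun (Map.pis_comp (proj F c) (incl F b)) y
    rw [proj_comp_incl_of_ne h, Map.pis_zero] at this
    exact this.symm
  have hbij : Function.Bijective s.pis := by
    constructor
    · rw [injective_iff_map_eq_zero]
      intro x hx
      have h0 := hs0 x
      have h1 := hs1 x
      rw [hx, map_zero] at h0 h1
      rw [← h0, zero_add] at h1
      rw [← hsum x, ← h0, ← h1, map_zero, map_zero, add_zero]
    · intro y
      refine ⟨(incl F true).pis ((proj F true).pis y - (proj F false).pis y) +
        (incl F false).pis ((proj F false).pis y), ?_⟩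
      rw [← hsum (s.pis _), hs0, hs1]
      have e0 : ∀ y z, (proj F false).pis ((incl F true).pis y + (incl F false).pis z) = z :=
        fun y z => by rw [map_add, hself, hne true false _ (by decide), zero_add]
      have e1 : ∀ y z, (proj F true).pis ((incl F true).pis y + (incl F false).pis z) = y :=
        fun y z => by rw [map_add, hself, hne false true _ (by decide), add_zero]
      rw [e0, e1, add_sub_cancel, hsum]
  obtain ⟨l, hl⟩ := hX.cw.exists_lift s hbij
    (Map.toPi (F := F) fun b => bif b then Map.zero X X else Map.id X)
  refine ⟨(proj F true).comp l, fun x => ?_⟩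
  have h0 : (proj F false).pis (l.pis x) = x := by
    rw [← hs0]
    have := DFunLike.congr_fun ((Map.Homotopic.refl (proj F false)).comp hl).pis x
    rw [proj_comp_toPi] at this
    simpa [Map.pis_comp, Map.pis_id] using this
  have h1 : (proj F false).pis (l.pis x) + (proj F true).pis (l.pis x) = 0 := by
    rw [← hs1]
    have := DFunLike.congr_fun ((Map.Homotopic.refl (proj F true)).comp hl).pis x
    rw [proj_comp_toPi, Map.pis_comp, Map.pis_comp] at this
    exact this.trans (DFunLike.congr_fun Map.pis_zero x)
  rw [h0] at h1
  rw [Map.pis_comp]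
  exact eq_neg_of_add_eq_zero_right h1

/-! ### Retracts of H-spaces -/

theorem Map.homotopic_of_eq {f g : Map X Y} (h : ∀ x, f.1 x = g.1 x) : f.Homotopic g := by
  rw [Map.ext h]
  exact Map.Homotopic.refl g

theorem IsRetract.isH [h : IsH X] (hZ : Z.IsRetract X) : IsH Z := by
  obtain ⟨H⟩ := h.nonempty
  obtain ⟨j, p, hpj⟩ := hZ
  let m : C(Z × Z, Z) := p.1.comp (H.toHSpace.hmul.comp (j.1.prodMap j.1))
  refine ⟨⟨HStructure.mk' m ?_ ?_ ?_⟩⟩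
  · change p.1 (H.toHSpace.hmul (j.1 Z.pt, j.1 Z.pt)) = Z.pt
    rw [j.2, H.hmul_pt, p.2]
  · refine Map.Homotopic.trans ?_
      (((Map.Homotopic.refl p).comp (H.zero_add_homotopic j)).trans hpj)
    refine Map.homotopic_of_eq fun x => ?_
    change p.1 (H.toHSpace.hmul (j.1 Z.pt, j.1 x)) = p.1 (H.toHSpace.hmul (X.pt, j.1 x))
    rw [j.2]
  · refine Map.Homotopic.trans ?_
      (((Map.Homotopic.refl p).comp (H.add_zero_homotopic j)).trans hpj)
    refine Map.homotopic_of_eq fun x => ?_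
    change p.1 (H.toHSpace.hmul (j.1 x, j.1 Z.pt)) = p.1 (H.toHSpace.hmul (j.1 x, X.pt))
    rw [j.2]

end

end PtdSpace

namespace PtdSpace

variable {X : PtdSpace.{u}} {Y : PtdSpace.{v}} {Z : PtdSpace.{w}}

/-! ### Realizable homomorphisms of homotopy groups -/

/-- Homomorphisms of homotopy groups which are induced by a map. -/
def Realizable (φ : X.Pis →+ Y.Pis) : Prop := ∃ f : Map X Y, f.pis = φ

theorem Realizable.comp {ψ : Y.Pis →+ Z.Pis} {φ : X.Pis →+ Y.Pis} (hψ : Realizable ψ)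
    (hφ : Realizable φ) : Realizable (ψ.comp φ) := by
  obtain ⟨g, rfl⟩ := hψ
  obtain ⟨f, rfl⟩ := hφ
  exact ⟨g.comp f, Map.pis_comp g f⟩

theorem Realizable.id : Realizable (AddMonoidHom.id X.Pis) := ⟨Map.id X, Map.pis_id⟩

theorem Realizable.zero : Realizable (0 : X.Pis →+ Y.Pis) := ⟨Map.zero X Y, Map.pis_zero⟩

theorem Realizable.add [h : IsH Y] {φ ψ : X.Pis →+ Y.Pis} (hφ : Realizable φ)
    (hψ : Realizable ψ) : Realizable (φ + ψ) := by
  obtain ⟨f, rfl⟩ := hφ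
  obtain ⟨g, rfl⟩ := hψ
  obtain ⟨H⟩ := h.nonempty
  exact ⟨Map.add H f g, Map.pis_add H f g⟩

theorem Realizable.neg [IsCWH Y] {φ : X.Pis →+ Y.Pis} (hφ : Realizable φ) : Realizable (-φ) := by
  obtain ⟨f, rfl⟩ := hφ
  obtain ⟨ν, hν⟩ := exists_pis_eq_neg Y
  refine ⟨ν.comp f, ?_⟩
  ext x
  rw [Map.pis_comp]
  exact hν _

theorem Realizable.sub [IsCWH Y] {φ ψ : X.Pis →+ Y.Pis} (hφ : Realizable φ)
    (hψ : Realizable ψ) : Realizable (φ - ψ) := by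
  rw [sub_eq_add_neg]
  exact hφ.add hψ.neg

theorem Realizable.sum [IsH Y] {ι : Type*} {φ : ι → X.Pis →+ Y.Pis} (s : Finset ι)
    (h : ∀ i ∈ s, Realizable (φ i)) : Realizable (∑ i ∈ s, φ i) :=
  Finset.sum_induction _ _ (fun _ _ => Realizable.add) Realizable.zero h

theorem Realizable.exists_inverse [IsCWH X] [IsCWH Y] {φ : X.Pis →+ Y.Pis} (hφ : Realizable φ)
    (hb : Function.Bijective φ) :
    ∃ ψ : Y.Pis →+ X.Pis, Realizable ψ ∧ (∀ x, ψ (φ x) = x) ∧ ∀ y, φ (ψ y) = y := by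
  obtain ⟨f, rfl⟩ := hφ
  obtain ⟨g, hgf, hfg⟩ := f.exists_inverse IsCWH.cw IsCWH.cw hb
  have h₁ := hgf.pis
  have h₂ := hfg.pis
  rw [Map.pis_comp, Map.pis_id] at h₁ h₂
  exact ⟨g.pis, ⟨g, rfl⟩, DFunLike.congr_fun h₁, DFunLike.congr_fun h₂⟩

/-- The ring of realizable endomorphisms of the homotopy groups is local. -/
structure IsLoc (X : PtdSpace.{u}) [IsH X] : Prop where
  id_ne_zero : AddMonoidHom.id X.Pis ≠ 0
  or_bijective : ∀ φ ψ : X.Pis →+ X.Pis, Realizable φ → Realizable ψ →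
    φ + ψ = AddMonoidHom.id X.Pis → Function.Bijective φ ∨ Function.Bijective ψ

section IsLoc

variable [IsCWH X] [IsCWH Y]

theorem IsLoc.or_bijective_of_add (hX : IsLoc X) {φ ψ : X.Pis →+ X.Pis} (hφ : Realizable φ)
    (hψ : Realizable ψ) (h : Function.Bijective ⇑(φ + ψ)) :
    Function.Bijective φ ∨ Function.Bijective ψ := by
  obtain ⟨u, hu, hu₁, hu₂⟩ := (hφ.add hψ).exists_inverse h
  have hub : Function.Bijective u :=
    ⟨Function.LeftInverse.injective hu₂, Function.RightInverse.surjective hu₁⟩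
  refine (hX.or_bijective (u.comp φ) (u.comp ψ) (hu.comp hφ) (hu.comp hψ) ?_).imp
    (fun h => ?_) fun h => ?_
  · rw [← AddMonoidHom.comp_add]
    exact AddMonoidHom.ext hu₁
  · exact hub.of_comp_iff' _ |>.1 h
  · exact hub.of_comp_iff' _ |>.1 h

theorem IsLoc.not_bijective_zero (hX : IsLoc X) : ¬ Function.Bijective ⇑(0 : X.Pis →+ X.Pis) :=
  fun h => hX.id_ne_zero (AddMonoidHom.ext fun _ => h.1 rfl)

theorem IsLoc.exists_bijective_of_sum (hX : IsLoc X) {ι : Type*} {φ : ι → X.Pis →+ X.Pis}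
    (hφ : ∀ i, Realizable (φ i)) (s : Finset ι) (h : Function.Bijective ⇑(∑ i ∈ s, φ i)) :
    ∃ i ∈ s, Function.Bijective (φ i) := by
  classical
  induction s using Finset.induction_on with
  | empty => exact absurd h hX.not_bijective_zero
  | insert a s ha ih =>
    rw [Finset.sum_insert ha] at h
    rcases hX.or_bijective_of_add (hφ a) (Realizable.sum s fun i _ => hφ i) h with h | h
    · exact ⟨a, Finset.mem_insert_self a s, h⟩
    · obtain ⟨i, hi, hb⟩ := ih h
      exact ⟨i, Finset.mem_insert_of_mem hi, hb⟩

/-- With u inverse to b ∘ a, the endomorphism a u b of Y is idempotent, hence 0 or 1 by locality; 0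
is excluded because it fixes the image of the injective a. -/
theorem IsLoc.bijective_of_comp (hY : IsLoc Y) (hX : AddMonoidHom.id X.Pis ≠ 0)
    {a : X.Pis →+ Y.Pis} {b : Y.Pis →+ X.Pis} (ha : Realizable a) (hb : Realizable b)
    (h : Function.Bijective (b.comp a)) : Function.Bijective a ∧ Function.Bijective b := by
  obtain ⟨u, hu, hu₁, hu₂⟩ := (hb.comp ha).exists_inverse h
  have hu₁' : ∀ x, u (b (a x)) = x := hu₁
  have hu₂' : ∀ x, b (a (u x)) = x := hu₂
  have ha₁ : Function.Injective a := fun x y hxy => by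
    rw [← hu₁' x, hxy, hu₁']
  have hb₁ : Function.Surjective b := fun x => ⟨_, hu₂' x⟩
  let e : Y.Pis →+ Y.Pis := a.comp (u.comp b)
  have he : ∀ y, e y = a (u (b y)) := fun _ => rfl
  have hee : ∀ y, e (e y) = e y := fun y => by rw [he y, he, hu₂']
  have her : Realizable e := ha.comp (hu.comp hb)
  rcases hY.or_bijective e (AddMonoidHom.id _ - e) her (Realizable.id.sub her)
    (add_sub_cancel _ _) with h' | h'
  · have he1 : ∀ y, e y = y := fun y => h'.1 (hee y)
    refine ⟨⟨ha₁, fun y => ⟨_, he1 y⟩⟩, ⟨fun y z hyz => ?_, hb₁⟩⟩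
    rw [← he1 y, ← he1 z, he, he, hyz]
  · exfalso
    have he0 : ∀ y, e y = 0 := fun y => h'.1 (by
      simp only [AddMonoidHom.sub_apply, AddMonoidHom.id_apply, hee, sub_self, map_zero])
    refine hX (AddMonoidHom.ext fun x => ?_)
    have h1 : e (a x) = a x := by rw [he, hu₁']
    rw [he0] at h1
    exact ha₁ (by rw [AddMonoidHom.id_apply, AddMonoidHom.zero_apply, map_zero, h1])

theorem IsLoc.of_bijective (hX : IsLoc X) {a : X.Pis →+ Y.Pis} (ha : Realizable a)
    (h : Function.Bijective a) : IsLoc Y := by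
  obtain ⟨b, hb, hba, hab⟩ := ha.exists_inverse h
  have hbb : Function.Bijective b :=
    ⟨Function.LeftInverse.injective hab, Function.RightInverse.surjective hba⟩
  refine ⟨fun h0 => hX.id_ne_zero (AddMonoidHom.ext fun x => h.1 ?_), fun φ ψ hφ hψ hs => ?_⟩
  · simpa using DFunLike.congr_fun h0 (a x)
  · refine (hX.or_bijective (b.comp (φ.comp a)) (b.comp (ψ.comp a)) (hb.comp (hφ.comp ha))
      (hb.comp (hψ.comp ha)) (AddMonoidHom.ext fun x => ?_)).imp (fun h' => ?_) fun h' => ?_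
    · have := DFunLike.congr_fun hs (a x)
      simp only [AddMonoidHom.add_apply, AddMonoidHom.id_apply] at this
      simp only [AddMonoidHom.add_apply, AddMonoidHom.comp_apply, AddMonoidHom.id_apply,
        ← map_add, this, hba]
    · exact (Function.Bijective.of_comp_iff _ h).1 ((hbb.of_comp_iff' _).1 h')
    · exact (Function.Bijective.of_comp_iff _ h).1 ((hbb.of_comp_iff' _).1 h')

end IsLoc

/-! ### Exchange -/

/-- For each k either a_k b_k or 1 - a_k b_k is invertible on the local F k. In the second case 1 -
b_k a_k is invertible on Z, so the k-th term can be dropped after rescaling the others. -/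
theorem exists_bijective_through {ι : Type*} {F : ι → PtdSpace.{v}} [∀ i, IsCWH (F i)]
    (hF : ∀ i, IsLoc (F i)) [IsCWH Z] (hZ : AddMonoidHom.id Z.Pis ≠ 0)
    {a : ∀ i, Z.Pis →+ (F i).Pis} (ha : ∀ i, Realizable (a i)) (s : Finset ι)
    {b : ∀ i, (F i).Pis →+ Z.Pis} (hb : ∀ i, Realizable (b i))
    (h : ∀ x, ∑ i ∈ s, b i (a i x) = x) :
    ∃ i, ∃ (a : Z.Pis →+ (F i).Pis) (b : (F i).Pis →+ Z.Pis), Realizable a ∧ Realizable b ∧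
      Function.Bijective (a.comp b) := by
  classical
  induction s using Finset.induction_on generalizing b with
  | empty => exact absurd (AddMonoidHom.ext fun x => (h x).symm) hZ
  | insert k s hk ih =>
    have hab := (ha k).comp (hb k)
    rcases (hF k).or_bijective ((a k).comp (b k)) (AddMonoidHom.id _ - (a k).comp (b k)) hab
      (Realizable.id.sub hab) (add_sub_cancel _ _) with h' | h'
    · exact ⟨k, a k, b k, ha k, hb k, h'⟩
    · obtain ⟨c, hc, hc₁, hc₂⟩ := (Realizable.id.sub hab).exists_inverse h'
      simp only [AddMonoidHom.sub_apply, AddMonoidHom.id_apply, AddMonoidHom.comp_apply] at hc₁ hc₂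
      -- With c = (1 - a_k b_k)⁻¹, the element 1 + b_k c a_k inverts 1 - b_k a_k.
      let r : Z.Pis →+ Z.Pis := AddMonoidHom.id _ + (b k).comp (c.comp (a k))
      have hr : Realizable r := Realizable.id.add ((hb k).comp (hc.comp (ha k)))
      refine ih (b := fun i => r.comp (b i)) (fun i => hr.comp (hb i)) fun x => ?_
      have hx := h x
      rw [Finset.sum_insert hk] at hx
      simp only [AddMonoidHom.comp_apply, ← map_sum]
      rw [← eq_sub_iff_add_eq'] at hx
      rw [hx]
      have h1 := hc₁ (a k x)
      rw [map_sub, sub_eq_iff_eq_add] at h1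
      simp only [r, AddMonoidHom.add_apply, AddMonoidHom.id_apply, AddMonoidHom.comp_apply,
        map_sub, h1, map_add]
      abel

/-- Gaussian elimination on mutually inverse matrices: locality makes some term N a k ∘ M k a of a
diagonal entry of the product invertible, and hence both its factors. Deleting row k and column a of
M leaves the remaining entries of M untouched, so the matching uses the original entries. -/
theorem exists_bijOn_of_matrix {ι κ : Type*} [DecidableEq ι] [DecidableEq κ] [Nonempty κ]
    {F : ι → PtdSpace.{v}} {F' : κ → PtdSpace.{t}}
    [∀ i, IsCWH (F i)] [∀ k, IsCWH (F' k)] (hF : ∀ i, IsLoc (F i)) (hF' : ∀ k, IsLoc (F' k))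
    {M : ∀ k i, (F i).Pis →+ (F' k).Pis} (hM : ∀ k i, Realizable (M k i))
    (s : Finset ι) (t : Finset κ)
    {N : ∀ i k, (F' k).Pis →+ (F i).Pis} (hN : ∀ i k, Realizable (N i k))
    (h₁ : ∀ i ∈ s, ∀ x, ∑ k ∈ t, N i k (M k i x) = x)
    (h₀ : ∀ i ∈ s, ∀ j ∈ s, i ≠ j → ∀ x, ∑ k ∈ t, N i k (M k j x) = 0)
    (h₁' : ∀ k ∈ t, ∀ x, ∑ i ∈ s, M k i (N i k x) = x)
    (h₀' : ∀ k ∈ t, ∀ l ∈ t, k ≠ l → ∀ x, ∑ i ∈ s, M k i (N i l x) = 0) :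
    ∃ σ : ι → κ, Set.BijOn σ s t ∧ ∀ i ∈ s, Function.Bijective (M (σ i) i) := by
  induction s using Finset.induction_on generalizing t N with
  | empty =>
    have ht : t = ∅ := by
      refine Finset.eq_empty_of_forall_notMem fun k hk => (hF' k).id_ne_zero ?_
      exact AddMonoidHom.ext fun x => (h₁' k hk x).symm
    exact ⟨fun _ => Classical.arbitrary κ, by simp [ht, Set.BijOn, Set.SurjOn], by simp⟩
  | insert a s ha ih =>
    have hmem := Finset.mem_insert_self a s
    have hsub : ∀ i ∈ s, i ∈ insert a s := fun i hi => Finset.mem_insert_of_mem hi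
    have hsa : ∀ i ∈ s, i ≠ a := fun i hi h => ha (h ▸ hi)
    obtain ⟨k, hk, hkb⟩ := (hF a).exists_bijective_of_sum
      (φ := fun k => (N a k).comp (M k a)) (fun k => (hN a k).comp (hM k a)) t (by
        have : ∑ k ∈ t, (N a k).comp (M k a) = AddMonoidHom.id _ := by
          ext x
          simpa [AddMonoidHom.finsetSum_apply] using h₁ a hmem x
        rw [this]
        exact Function.bijective_id)
    obtain ⟨hMb, hNb⟩ := (hF' k).bijective_of_comp (hF a).id_ne_zero (hM k a) (hN a k) hkb
    obtain ⟨n, hn, hn₁, hn₂⟩ := (hN a k).exists_inverse hNb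
    -- The Schur complement of the invertible entry N a k is the inverse of the reduced matrix.
    let N' : ∀ i l, (F' l).Pis →+ (F i).Pis := fun i l =>
      N i l - (N i k).comp (n.comp (N a l))
    have hN' : ∀ i l, Realizable (N' i l) := fun i l =>
      (hN i l).sub ((hN i k).comp (hn.comp (hN a l)))
    have hN'a : ∀ i l x, N' i l x = N i l x - N i k (n (N a l x)) := fun _ _ _ => rfl
    have hte : ∀ l ∈ t.erase k, l ∈ t := fun l hl => Finset.mem_of_mem_erase hl
    have sumt : ∀ i j x, ∑ l ∈ t.erase k, N i l (M l j x) =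
        ∑ l ∈ t, N i l (M l j x) - N i k (M k j x) := fun i j x => by
      rw [← Finset.add_sum_erase t _ hk, add_sub_cancel_left]
    have sums : ∀ l m x, ∑ i ∈ s, M l i (N i m x) =
        ∑ i ∈ insert a s, M l i (N i m x) - M l a (N a m x) := fun l m x => by
      rw [Finset.sum_insert ha, add_sub_cancel_left]
    have col : ∀ i ∈ s, ∀ j ∈ s, ∀ x, ∑ l ∈ t.erase k, N' i l (M l j x) =
        ∑ l ∈ t, N i l (M l j x) := by
      intro i hi j hj x
      simp only [hN'a, Finset.sum_sub_distrib, ← map_sum]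
      rw [sumt, sumt, h₀ a hmem j (hsub j hj) (hsa j hj).symm, zero_sub, map_neg, map_neg, hn₁]
      abel
    have row : ∀ l ∈ t.erase k, ∀ m x, ∑ i ∈ s, M l i (N' i m x) =
        ∑ i ∈ insert a s, M l i (N i m x) := by
      intro l hl m x
      simp only [hN'a, map_sub, Finset.sum_sub_distrib]
      rw [sums, sums, h₀' l (hte l hl) k hk (Finset.ne_of_mem_erase hl), zero_sub, hn₂]
      abel
    obtain ⟨σ, hσ, hσb⟩ := ih (t.erase k) hN'
      (fun i hi x => by rw [col i hi i hi, h₁ i (hsub i hi)])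
      (fun i hi j hj hij x => by rw [col i hi j hj, h₀ i (hsub i hi) j (hsub j hj) hij])
      (fun l hl x => by rw [row l hl, h₁' l (hte l hl)])
      (fun l hl m hm hlm x => by rw [row l hl, h₀' l (hte l hl) m (hte m hm) hlm])
    have hσs : ∀ i ∈ s, Function.update σ a k i = σ i := fun i hi =>
      Function.update_of_ne (hsa i hi) _ _
    refine ⟨Function.update σ a k, ?_, fun i hi => ?_⟩
    · have h1 : Set.BijOn (Function.update σ a k) s (t.erase k : Finset κ) :=
        hσ.congr fun i hi => (hσs i hi).symm
      have h2 := h1.insert (a := a) (by simp)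
      rw [Function.update_self] at h2
      rwa [← Finset.coe_insert, ← Finset.coe_insert, Finset.insert_erase hk] at h2
    · rcases Finset.mem_insert.1 hi with rfl | hi
      · rw [Function.update_self]; exact hMb
      · rw [hσs i hi]; exact hσb i hi

end PtdSpace

/-! ### Maximal `N`-subloops -/

theorem IsNSubloop.sUnion {N : Type u} [Zero N] [Add N] [Mul N] {c : Set (Set N)}
    (hc : ∀ I ∈ c, IsNSubloop I) (hchain : IsChain (· ⊆ ·) c) (hne : c.Nonempty) :
    IsNSubloop (⋃₀ c) := by
  have two : ∀ a ∈ ⋃₀ c, ∀ b ∈ ⋃₀ c, ∃ I ∈ c, a ∈ I ∧ b ∈ I := by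
    rintro a ⟨I, hI, ha⟩ b ⟨I', hI', hb⟩
    rcases hchain.total hI hI' with h | h
    · exact ⟨I', hI', h ha, hb⟩
    · exact ⟨I, hI, ha, h hb⟩
  obtain ⟨I₀, hI₀⟩ := hne
  refine ⟨⟨I₀, hI₀, (hc _ hI₀).zero_mem⟩, fun a ha b hb => ?_, fun a ha b hb x hx => ?_,
    fun a ha b hb x hx => ?_, fun n a ha => ?_⟩
  · obtain ⟨I, hI, ha, hb⟩ := two a ha b hb
    exact ⟨I, hI, (hc I hI).add_mem a ha b hb⟩
  · obtain ⟨I, hI, ha, hb⟩ := two a ha b hb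
    exact ⟨I, hI, (hc I hI).left_diff_mem a ha b hb x hx⟩
  · obtain ⟨I, hI, ha, hb⟩ := two a ha b hb
    exact ⟨I, hI, (hc I hI).right_diff_mem a ha b hb x hx⟩
  · obtain ⟨I, hI, ha⟩ := ha
    exact ⟨I, hI, (hc I hI).mul_mem n a ha⟩

theorem IsNSubloop.eq_univ {N : Type u} [Zero N] [Add N] [Mul N] {e : N} (he : ∀ n : N, n * e = n)
    {I : Set N} (hI : IsNSubloop I) (h : e ∈ I) : I = Set.univ :=
  Set.eq_univ_of_forall fun n => he n ▸ hI.mul_mem n e h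

/-- Zorn's lemma: a right identity makes properness of an `N`-subloop equivalent to omitting e,
which survives unions of chains. -/
theorem IsNSubloop.exists_le_maximal {N : Type u} [Zero N] [Add N] [Mul N] {e : N}
    (he : ∀ n : N, n * e = n) {I : Set N} (hI : IsNSubloop I) (h : e ∉ I) :
    ∃ J : Set N, IsMaximalNSubloop J ∧ I ⊆ J := by
  obtain ⟨J, hIJ, hJ⟩ := zorn_subset_nonempty {K : Set N | IsNSubloop K ∧ e ∉ K}
    (fun c hc hchain hne => ⟨⋃₀ c, ⟨IsNSubloop.sUnion (fun K hK => (hc hK).1) hchain hne, by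
      rintro ⟨K, hK, heK⟩
      exact (hc hK).2 heK⟩, fun K hK => Set.subset_sUnion_of_mem hK⟩) I ⟨hI, h⟩
  refine ⟨J, ⟨hJ.prop.1, fun hu => hJ.prop.2 (hu ▸ Set.mem_univ e), fun K hK hKu hJK => ?_⟩, hIJ⟩
  exact (hJ.eq_of_subset ⟨hK, fun heK => hKu (hK.eq_univ he heK)⟩ hJK).symm

namespace PtdSpace

variable {X : PtdSpace.{u}} {Y : PtdSpace.{v}} {Z : PtdSpace.{w}}

/-! ### Local loop near-rings of self-maps -/

section End

variable {H : HStructure X}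

/-- The endomorphism of homotopy groups induced by a class of self-maps. -/
noncomputable def End.pis (a : End X H) : X.Pis →+ X.Pis :=
  Quotient.lift (s := Map.setoid X X) (fun f : Map X X => f.pis) (fun _ _ h => h.pis) a

/-- The class of a self-map. -/
def End.mk (H : HStructure X) (f : Map X X) : End X H := Quotient.mk (Map.setoid X X) f

theorem End.mk_surjective : Function.Surjective (End.mk H) := Quotient.mk_surjective

theorem End.mk_eq {f g : Map X X} : End.mk H f = End.mk H g ↔ f.Homotopic g :=
  Quotient.eq (r := Map.setoid X X)

theorem End.mk_mul (f g : Map X X) : End.mk H f * End.mk H g = End.mk H (f.comp g) := rfl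

theorem End.mk_zero : End.mk H (Map.zero X X) = 0 := rfl

theorem End.mk_one : End.mk H (Map.id X) = 1 := rfl

theorem End.mul_one (a : End X H) : a * 1 = a := by
  obtain ⟨f, rfl⟩ := End.mk_surjective a
  rfl

theorem End.mul_zero (a : End X H) : a * 0 = 0 := by
  obtain ⟨f, rfl⟩ := End.mk_surjective a
  rw [← End.mk_zero, End.mk_mul, Map.comp_zero]

theorem End.pis_mul (a b : End X H) : (a * b).pis = a.pis.comp b.pis := by
  obtain ⟨f, rfl⟩ := End.mk_surjective a
  obtain ⟨g, rfl⟩ := End.mk_surjective b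
  exact Map.pis_comp f g

theorem End.pis_add [IsH X] (a b : End X H) : (a + b).pis = a.pis + b.pis := by
  obtain ⟨f, rfl⟩ := End.mk_surjective a
  obtain ⟨g, rfl⟩ := End.mk_surjective b
  exact Map.pis_add H f g

theorem End.pis_zero : (0 : End X H).pis = 0 := Map.pis_zero

theorem End.pis_one : (1 : End X H).pis = AddMonoidHom.id _ := Map.pis_id

theorem End.realizable (a : End X H) : Realizable a.pis := by
  obtain ⟨f, rfl⟩ := End.mk_surjective a
  exact ⟨f, rfl⟩

theorem Realizable.exists_end (H : HStructure X) {φ : X.Pis →+ X.Pis} (h : Realizable φ) :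
    ∃ a : End X H, a.pis = φ := by
  obtain ⟨f, rfl⟩ := h
  exact ⟨End.mk H f, rfl⟩

theorem End.exists_mul_eq_one [IsCWH X] {a : End X H} (h : Function.Bijective a.pis) :
    ∃ b : End X H, b * a = 1 := by
  obtain ⟨f, rfl⟩ := End.mk_surjective a
  obtain ⟨g, hg, -⟩ := f.exists_inverse IsCWH.cw IsCWH.cw h
  exact ⟨End.mk H g, End.mk_eq.2 hg⟩

/-- The self-maps inducing a left multiple of a given endomorphism of the homotopy groups form an
`N`-subloop. -/
theorem isNSubloop_leftMultiples [IsCWH X] (H : HStructure X) (φ : X.Pis →+ X.Pis) :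
    IsNSubloop {a : End X H | ∃ n : End X H, a.pis = n.pis.comp φ} := by
  have hsub : ∀ n m : End X H, ∃ k : End X H, k.pis = n.pis - m.pis := fun n m =>
    (n.realizable.sub m.realizable).exists_end H
  refine ⟨⟨0, ?_⟩, ?_, ?_, ?_, ?_⟩
  · rw [End.pis_zero]; rfl
  · rintro a ⟨n, hn⟩ b ⟨m, hm⟩
    exact ⟨n + m, by rw [End.pis_add, End.pis_add, hn, hm, AddMonoidHom.add_comp]⟩
  · rintro a ⟨n, hn⟩ b ⟨m, hm⟩ x rfl
    obtain ⟨k, hk⟩ := hsub m n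
    refine ⟨k, ?_⟩
    rw [End.pis_add, hn] at hm
    rw [hk, sub_eq_add_neg, AddMonoidHom.add_comp, ← hm]
    ext y
    simp
  · rintro a ⟨n, hn⟩ b ⟨m, hm⟩ x rfl
    obtain ⟨k, hk⟩ := hsub m n
    refine ⟨k, ?_⟩
    rw [End.pis_add, hn] at hm
    rw [hk, sub_eq_add_neg, AddMonoidHom.add_comp, ← hm]
    ext y
    simp
  · rintro k a ⟨n, hn⟩
    exact ⟨k * n, by rw [End.pis_mul, End.pis_mul, hn, AddMonoidHom.comp_assoc]⟩

/-- If neither of two summands of 1 is left invertible, their left multiples lie in proper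
`N`-subloops, so both lie in the unique maximal one; but their sum is a unit. -/
theorem StronglyIndecomposable.isLoc [IsCWH X] (h : X.StronglyIndecomposable H) : IsLoc X := by
  obtain ⟨J, hJ, hJu⟩ := h
  have h1J : (1 : End X H) ∉ J := fun h => hJ.2.1 (hJ.1.eq_univ End.mul_one h)
  have hne : AddMonoidHom.id X.Pis ≠ 0 := by
    intro h0
    have hb : Function.Bijective (0 : End X H).pis := by
      rw [End.pis_zero, ← h0]
      exact Function.bijective_id
    obtain ⟨b, hb⟩ := End.exists_mul_eq_one hb
    rw [End.mul_zero] at hb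
    exact h1J (hb ▸ hJ.1.zero_mem)
  have left : ∀ φ ψ : X.Pis →+ X.Pis, Realizable φ → Realizable ψ →
      φ + ψ = AddMonoidHom.id X.Pis → (∃ n : End X H, n.pis.comp φ = AddMonoidHom.id _) ∨
        ∃ n : End X H, n.pis.comp ψ = AddMonoidHom.id _ := by
    intro φ ψ hφ hψ hs
    by_contra! hcon
    have sub : ∀ χ : X.Pis →+ X.Pis, (∀ n : End X H, n.pis.comp χ ≠ AddMonoidHom.id _) →
        ∀ a : End X H, a.pis = χ → a ∈ J := by
      intro χ hχ a ha
      obtain ⟨J', hJ', hle⟩ := (isNSubloop_leftMultiples H χ).exists_le_maximal End.mul_one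
        (fun ⟨n, hn⟩ => hχ n (by rw [← hn, End.pis_one]))
      rw [← hJu J' hJ']
      exact hle ⟨1, by rw [ha, End.pis_one, AddMonoidHom.id_comp]⟩
    obtain ⟨a, ha⟩ := hφ.exists_end H
    obtain ⟨b, hb⟩ := hψ.exists_end H
    have hab : a + b ∈ J := hJ.1.add_mem a (sub φ hcon.1 a ha) b (sub ψ hcon.2 b hb)
    obtain ⟨c, hc⟩ := End.exists_mul_eq_one (a := a + b) (by
      rw [End.pis_add, ha, hb, hs]
      exact Function.bijective_id)
    exact h1J (hc ▸ hJ.1.mul_mem c _ hab)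
  -- If n φ = 1, the dichotomy for φ n and 1 - φ n decides: a left invertible idempotent is 1, and 1
  -- - φ n is excluded since it kills the image of φ.
  have bij : ∀ φ : X.Pis →+ X.Pis, Realizable φ →
      (∃ n : End X H, n.pis.comp φ = AddMonoidHom.id _) → Function.Bijective φ := by
    rintro φ hφ ⟨n, hn⟩
    have hn' : ∀ x, n.pis (φ x) = x := DFunLike.congr_fun hn
    have her := hφ.comp n.realizable
    rcases left (φ.comp n.pis) (AddMonoidHom.id _ - φ.comp n.pis) her (Realizable.id.sub her)
      (add_sub_cancel _ _) with ⟨m, hm⟩ | ⟨m, hm⟩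
    · have hm' : ∀ x, m.pis (φ (n.pis x)) = x := DFunLike.congr_fun hm
      refine ⟨Function.LeftInverse.injective hn', fun x => ⟨n.pis x, ?_⟩⟩
      rw [← hm' (φ (n.pis x)), hn', hm']
    · have hm' : ∀ x, m.pis (x - φ (n.pis x)) = x := DFunLike.congr_fun hm
      refine absurd (AddMonoidHom.ext fun x => ?_) hne
      have h1 := hm' (φ x)
      rw [hn', sub_self, map_zero] at h1
      have h2 := hn' x
      rw [← h1, map_zero] at h2
      exact h2.symm
  exact ⟨hne, fun φ ψ hφ hψ hs => (left φ ψ hφ hψ hs).imp (bij φ hφ) (bij ψ hψ)⟩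

/-- The non-units form an `N`-subloop by locality, and every proper `N`-subloop consists of
non-units. -/
theorem IsLoc.stronglyIndecomposable [IsCWH X] (h : IsLoc X) (H : HStructure X) :
    X.StronglyIndecomposable H := by
  have hJ : IsNSubloop {a : End X H | ¬ Function.Bijective a.pis} := by
    have diff : ∀ φ ψ χ : X.Pis →+ X.Pis, Realizable φ → Realizable ψ → φ + χ = ψ →
        ¬ Function.Bijective φ → ¬ Function.Bijective ψ → ¬ Function.Bijective χ := by
      intro φ ψ χ hφ hψ hs h₁ h₂ h₃
      rw [← neg_add_eq_iff_eq_add.2 hs.symm] at h₃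
      rcases h.or_bijective_of_add hφ.neg hψ h₃ with h' | h'
      · exact h₁ ((Equiv.neg X.Pis).bijective.of_comp_iff' _ |>.1 h')
      · exact h₂ h'
    refine ⟨?_, fun a ha b hb => ?_, fun a ha b hb x hx => ?_, fun a ha b hb x hx => ?_,
      fun n a ha => ?_⟩
    · rw [Set.mem_ofPred_eq, End.pis_zero]
      exact h.not_bijective_zero
    · rw [Set.mem_ofPred_eq, End.pis_add]
      exact fun hab => (h.or_bijective_of_add a.realizable b.realizable hab).elim ha hb
    · exact diff _ _ _ a.realizable b.realizable (by rw [← hx, End.pis_add]) ha hb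
    · exact diff _ _ _ a.realizable b.realizable (by rw [← hx, End.pis_add, add_comm]) ha hb
    · rw [Set.mem_ofPred_eq, End.pis_mul]
      exact fun hna => ha (h.bijective_of_comp h.id_ne_zero a.realizable n.realizable hna).1
  have hle : ∀ K : Set (End X H), IsNSubloop K → K ≠ Set.univ →
      K ⊆ {a : End X H | ¬ Function.Bijective a.pis} := by
    intro K hK hKu a ha hab
    obtain ⟨b, hb⟩ := End.exists_mul_eq_one hab
    exact hKu (hK.eq_univ End.mul_one (hb ▸ hK.mul_mem b a ha))
  have hprop : {a : End X H | ¬ Function.Bijective a.pis} ≠ Set.univ := by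
    intro hu
    have : (1 : End X H) ∈ {a : End X H | ¬ Function.Bijective a.pis} := hu ▸ Set.mem_univ _
    rw [Set.mem_ofPred_eq, End.pis_one] at this
    exact this Function.bijective_id
  refine ⟨_, ⟨hJ, hprop, fun K hK hKu hJK => (hle K hK hKu).antisymm hJK⟩, fun K hK => ?_⟩
  exact (hK.2.2 _ hJ hprop (hle K hK.1 hK.2.1)).symm

end End

/-! ### Indecomposable retracts -/

theorem Indecomposable.id_ne_zero (hZ : Z.Indecomposable) (hc : Z.HasConnectedCWType) :
    AddMonoidHom.id Z.Pis ≠ 0 := by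
  intro h0
  obtain ⟨g, hg, -⟩ := (Map.zero Z Z).exists_inverse hc hc (by
    rw [Map.pis_zero, ← h0]
    exact Function.bijective_id)
  rw [Map.comp_zero] at hg
  exact hZ.1 (Quotient.sound hg)

theorem HEquiv.of_bijective (hX : X.HasConnectedCWType) (hY : Y.HasConnectedCWType)
    {φ : X.Pis →+ Y.Pis} (hφ : Realizable φ) (h : Function.Bijective φ) : X.HEquiv Y := by
  obtain ⟨f, rfl⟩ := hφ
  obtain ⟨g, h₁, h₂⟩ := f.exists_inverse hX hY h
  exact ⟨f, g, h₁, h₂⟩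

/-- Indecomposability concerns idempotent homotopy classes, so an idempotent on homotopy groups
alone would not do. Whitehead's theorem supplies a homotopy inverse k of f g, and g k f is then
idempotent up to homotopy. -/
theorem Indecomposable.bijective_of_comp [IsCWH Y] (hY : AddMonoidHom.id Y.Pis ≠ 0)
    (hZ : Z.Indecomposable) {a : Z.Pis →+ Y.Pis} {b : Y.Pis →+ Z.Pis} (ha : Realizable a)
    (hb : Realizable b) (h : Function.Bijective (a.comp b)) :
    Function.Bijective a := by
  obtain ⟨f, rfl⟩ := ha
  obtain ⟨g, rfl⟩ := hb
  rw [← Map.pis_comp] at h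
  obtain ⟨k, hk₁, hk₂⟩ := (f.comp g).exists_inverse IsCWH.cw IsCWH.cw h
  let e : Map Z Z := (g.comp k).comp f
  have hee : (e.comp e).Homotopic e :=
    (((Map.Homotopic.refl (g.comp k)).comp (hk₂.comp (Map.Homotopic.refl f))) :)
  have hfe : ∀ y, f.pis (g.pis (k.pis y)) = y := by
    have := hk₂.pis
    rw [Map.pis_comp, Map.pis_comp, Map.pis_id] at this
    exact DFunLike.congr_fun this
  have he : ∀ z, e.pis z = g.pis (k.pis (f.pis z)) := fun z => by
    rw [Map.pis_comp, Map.pis_comp]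
    rfl
  rcases hZ.2 (Quotient.mk _ e) (Quotient.sound hee) with h' | h'
  · have h0 : e.pis = 0 := (Map.Homotopic.pis (Quotient.exact h')).trans Map.pis_zero
    refine absurd (AddMonoidHom.ext fun y => ?_) hY
    -- Using f g k = 1 twice writes y as f applied to a value of e, which vanishes.
    rw [AddMonoidHom.id_apply, ← hfe y, ← hfe (f.pis (g.pis (k.pis y))), ← he, h0]
    simp
  · have h1 : e.pis = AddMonoidHom.id _ := (Map.Homotopic.pis (Quotient.exact h')).trans Map.pis_id
    refine ⟨fun x y hxy => ?_, fun y => ⟨_, hfe y⟩⟩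
    have hx := he x
    have hy := he y
    rw [h1, AddMonoidHom.id_apply] at hx hy
    rw [hx, hy, hxy]

/-! ### Splittings and comparison of two decompositions -/

/-- A family of retracts of a space, whose idempotents add up to the identity. -/
structure Splitting (X : PtdSpace.{u}) [IsH X] {ι : Type*} [Fintype ι]
    (F : ι → PtdSpace.{v}) where
  inc : ∀ i, (F i).Pis →+ X.Pis
  prj : ∀ i, X.Pis →+ (F i).Pis
  realizable_inc : ∀ i, Realizable (inc i)
  realizable_prj : ∀ i, Realizable (prj i)
  sum_eq : ∀ x, ∑ i, inc i (prj i x) = x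
  prj_inc_self : ∀ i x, prj i (inc i x) = x
  prj_inc_of_ne : ∀ i j x, i ≠ j → prj j (inc i x) = 0

theorem HEquiv.isRetract {ι : Type*} {F : ι → PtdSpace.{v}} (h : X.HEquiv (pi F)) (i : ι) :
    (F i).IsRetract X := by
  classical
  obtain ⟨f, g, -, hfg⟩ := h
  refine ⟨g.comp (incl F i), (proj F i).comp f, ?_⟩
  have h₁ := (Map.Homotopic.refl (proj F i)).comp (hfg.comp (Map.Homotopic.refl (incl F i)))
  rw [Map.id_comp, proj_comp_incl_self] at h₁
  exact h₁

theorem HEquiv.nonempty_splitting {ι : Type*} [Fintype ι] {F : ι → PtdSpace.{v}} [IsH X]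
    [∀ i, IsH (F i)] (h : X.HEquiv (pi F)) : Nonempty (Splitting X F) := by
  classical
  obtain ⟨f, g, hgf, hfg⟩ := h
  have h₁ : ∀ x, g.pis (f.pis x) = x := by
    have := hgf.pis
    rw [Map.pis_comp, Map.pis_id] at this
    exact DFunLike.congr_fun this
  have h₂ : ∀ x, f.pis (g.pis x) = x := by
    have := hfg.pis
    rw [Map.pis_comp, Map.pis_id] at this
    exact DFunLike.congr_fun this
  exact ⟨{
    inc := fun i => g.pis.comp (incl F i).pis
    prj := fun i => (proj F i).pis.comp f.pis
    realizable_inc := fun i => ⟨g.comp (incl F i), Map.pis_comp _ _⟩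
    realizable_prj := fun i => ⟨(proj F i).comp f, Map.pis_comp _ _⟩
    sum_eq := fun x => by
      simp only [AddMonoidHom.comp_apply, ← map_sum]
      rw [sum_incl_proj, h₁]
    prj_inc_self := fun i x => by
      simp only [AddMonoidHom.comp_apply, h₂]
      rw [← AddMonoidHom.comp_apply, ← Map.pis_comp, proj_comp_incl_self, Map.pis_id]
      rfl
    prj_inc_of_ne := fun i j x hij => by
      simp only [AddMonoidHom.comp_apply, h₂]
      rw [← AddMonoidHom.comp_apply, ← Map.pis_comp, proj_comp_incl_of_ne hij, Map.pis_zero]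
      rfl }⟩

theorem Splitting.exists_bijective [IsH X] {ι : Type*} [Fintype ι] {F : ι → PtdSpace.{v}}
    [∀ i, IsCWH (F i)] (S : Splitting X F) (hF : ∀ i, IsLoc (F i)) [IsCWH Z]
    (hZ : Z.Indecomposable) (hr : Z.IsRetract X) :
    ∃ i, ∃ a : Z.Pis →+ (F i).Pis, Realizable a ∧ Function.Bijective a := by
  obtain ⟨j, p, hpj⟩ := hr
  have h : ∀ x, p.pis (j.pis x) = x := by
    have := hpj.pis
    rw [Map.pis_comp, Map.pis_id] at this
    exact DFunLike.congr_fun this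
  obtain ⟨i, a, b, ha, hb, hab⟩ := exists_bijective_through hF (hZ.id_ne_zero IsCWH.cw)
    (a := fun i => (S.prj i).comp j.pis) (fun i => (S.realizable_prj i).comp ⟨j, rfl⟩) Finset.univ
    (b := fun i => p.pis.comp (S.inc i)) (fun i => Realizable.comp ⟨p, rfl⟩ (S.realizable_inc i))
    (fun x => by
      simp only [AddMonoidHom.comp_apply, ← map_sum]
      rw [S.sum_eq, h])
  exact ⟨i, a, ha, hZ.bijective_of_comp (hF i).id_ne_zero ha hb hab⟩

theorem Splitting.exists_equiv [IsH X] {ι κ : Type*} [Fintype ι] [Fintype κ]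
    {F : ι → PtdSpace.{v}} {F' : κ → PtdSpace.{t}} [∀ i, IsCWH (F i)] [∀ k, IsCWH (F' k)]
    (S : Splitting X F) (S' : Splitting X F') (hF : ∀ i, IsLoc (F i)) (hF' : ∀ k, IsLoc (F' k)) :
    ∃ σ : ι ≃ κ, ∀ i, (F i).HEquiv (F' (σ i)) := by
  classical
  have e1 : ∀ i j x, ∑ k, (S.prj i).comp (S'.inc k) ((S'.prj k).comp (S.inc j) x) =
      S.prj i (S.inc j x) := fun i j x => by
    simp only [AddMonoidHom.comp_apply, ← map_sum, S'.sum_eq]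
  have e2 : ∀ k l x, ∑ i, (S'.prj k).comp (S.inc i) ((S.prj i).comp (S'.inc l) x) =
      S'.prj k (S'.inc l x) := fun i j x => by
    simp only [AddMonoidHom.comp_apply, ← map_sum, S.sum_eq]
  -- The matching lemma needs a default value in κ. If κ is empty, the identity of each F i is an
  -- empty sum, so ι is empty too.
  rcases isEmpty_or_nonempty κ with hκ | hκ
  · have : IsEmpty ι := ⟨fun i => (hF i).id_ne_zero (AddMonoidHom.ext fun x => by
      have := e1 i i x
      rw [S.prj_inc_self] at this
      simpa using this.symm)⟩
    exact ⟨Equiv.equivOfIsEmpty ι κ, fun i => isEmptyElim i⟩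
  · obtain ⟨σ, hσ, hb⟩ := exists_bijOn_of_matrix hF hF'
      (M := fun k i => (S'.prj k).comp (S.inc i))
      (fun k i => (S'.realizable_prj k).comp (S.realizable_inc i)) Finset.univ Finset.univ
      (N := fun i k => (S.prj i).comp (S'.inc k))
      (fun i k => (S.realizable_prj i).comp (S'.realizable_inc k))
      (fun i _ x => by rw [e1, S.prj_inc_self])
      (fun i _ j _ hij x => by rw [e1, S.prj_inc_of_ne _ _ _ hij.symm])
      (fun k _ x => by rw [e2, S'.prj_inc_self])
      (fun k _ l _ hkl x => by rw [e2, S'.prj_inc_of_ne _ _ _ hkl.symm])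
    rw [Finset.coe_univ, Finset.coe_univ, Set.bijOn_univ] at hσ
    exact ⟨Equiv.ofBijective σ hσ, fun i => HEquiv.of_bijective IsCWH.cw IsCWH.cw
      ((S'.realizable_prj _).comp (S.realizable_inc i)) (hb i (Finset.mem_univ i))⟩

end PtdSpace

/-! ### The decomposition theorem -/

theorem mainTheorem2
    (X : PtdSpace.{u}) (hX : X.HasConnectedCWType) (HX : X.HStructure)
    (n : ℕ) (F : Fin n → PtdSpace.{v}) (hF : ∀ i, (F i).HasConnectedCWType)
    (HF : ∀ i, (F i).HStructure) (hFs : ∀ i, (F i).StronglyIndecomposable (HF i))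
    (hXF : X.HEquiv (PtdSpace.pi F)) :
    (∀ Z : PtdSpace.{w}, Z.HasConnectedCWType → Z.IsRetract X → Z.Indecomposable →
      (Nonempty Z.HStructure ∧ ∀ HZ : Z.HStructure, Z.StronglyIndecomposable HZ) ∧
        ∃ i, Z.HEquiv (F i)) ∧
    (∀ (m : ℕ) (F' : Fin m → PtdSpace.{t}), (∀ k, (F' k).HasConnectedCWType) →
      (∀ k, (F' k).Indecomposable) → X.HEquiv (PtdSpace.pi F') →
      m = n ∧ ∃ φ : Fin n ≃ Fin m, ∀ i, (F i).HEquiv (F' (φ i))) := by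
  have hXH : X.IsH := ⟨⟨HX⟩⟩
  have hFH : ∀ i, (F i).IsCWH := fun i => { nonempty := ⟨HF i⟩, cw := hF i }
  have hFl : ∀ i, (F i).IsLoc := fun i => (hFs i).isLoc
  obtain ⟨S⟩ := hXF.nonempty_splitting
  refine ⟨fun Z hZc hZr hZ => ?_, fun m F' hFc' hFi' hXF' => ?_⟩
  · have hZH : Z.IsCWH := { hZr.isH with cw := hZc }
    obtain ⟨i, a, ha, hab⟩ := S.exists_bijective hFl hZ hZr
    have hZF : Z.HEquiv (F i) := PtdSpace.HEquiv.of_bijective hZc (hF i) ha hab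
    obtain ⟨b, hb, hba, hab'⟩ := ha.exists_inverse hab
    have hZl : Z.IsLoc := (hFl i).of_bijective hb
      ⟨Function.LeftInverse.injective hab', Function.RightInverse.surjective hba⟩
    exact ⟨⟨hZH.nonempty, hZl.stronglyIndecomposable⟩, i, hZF⟩
  · have hFH' : ∀ k, (F' k).IsCWH := fun k => { (hXF'.isRetract k).isH with cw := hFc' k }
    -- Each F' k is an indecomposable retract of X, hence equivalent to some F i, and locality is
    -- transported along the equivalence.
    have hFl' : ∀ k, (F' k).IsLoc := fun k => by
      obtain ⟨i, a, ha, hab⟩ := S.exists_bijective hFl (hFi' k) (hXF'.isRetract k)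
      obtain ⟨b, hb, hba, hab'⟩ := ha.exists_inverse hab
      exact (hFl i).of_bijective hb
        ⟨Function.LeftInverse.injective hab', Function.RightInverse.surjective hba⟩
    obtain ⟨S'⟩ := hXF'.nonempty_splitting
    obtain ⟨σ, hσ⟩ := S.exists_equiv S' hFl hFl'
    exact ⟨by simpa using (Fintype.card_congr σ).symm, σ, hσ⟩
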